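/- Let $\mathcal X,\mathcal Y$ be finite alphabets, $P_X$ a distribution on $\mathcal X$ with support $\mathcal S$ ($\mathcal S=\mathcal X$ if $P_X$ has full support), $d:\mathcal X\times\mathcal Y\to\mathbb R$ a distortion function, $D\in\mathbb R$, and $B_D(x)=\{y\in\mathcal Y: d(x,y)\le D\}$. For a mechanism $P_{Y|X}$ and $\alpha\in[1,\infty]$ the maximal $\alpha$-leakage is $$\mathcal L_\alpha^{\max}(X\to Y)=\sup_{U-X-Y}\ \lim_{\alpha'\to\alpha}\frac{\alpha'}{\alpha'-1}\log\frac{\max_{P_{\hat U|Y}}\mathbb E\big[\mathbb P(U=\hat U\mid U,Y)^{\frac{\alpha'-1}{\alpha'}}\big]}{\max_{P_{\hat U}}\mathbb E\big[\mathbb P(U=\hat U\mid U)^{\frac{\alpha'-1}{\alpha'}}\big]},$$ where $\alpha'$ ranges over $(1,\infty)$, and $U$ ranges over all (possibly randomized) functions of $X$ with values in an arbitrary finite alphabet; the limit always exists. Let $$\mathrm{PUT}_\alpha(D)=\inf_{P_{Y|X}:\ d(X,Y)\le D\text{ with probability }1}\mathcal L_\alpha^{\max}(X\to Y),\qquad q^\star=\sup_{Q_Y}\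 \inf_{x\in\mathcal S}Q_Y(B_D(x)),$$ with $Q_Y$ ranging over the distributions on $\mathcal Y$, $\log\frac10=-\log 0=+\infty$, $0\cdot\infty=0$ and $\inf\emptyset=+\infty$ (and $\sup\emptyset=0$ in $q^\star$). Then $$\mathrm{PUT}_1(D)=\inf_{Q_Y}\mathbb E\Big[\log\frac{1}{Q_Y(B_D(X))}\Big],\qquad \mathrm{PUT}_\alpha(D)=-\log q^\star\quad\text{for every }\alpha\in(1,\infty].$$ Moreover, suppose that $B_D(x)\ne\emptyset$ for every $x\in\mathcal S$. Then the infimum over $Q_Y$ in the formula for $\alpha=1$ and the supremum over $Q_Y$ in $q^\star$ are attained. If $Q_Y^\star$ attains the infimum (for $\alpha=1$), respectively the supremum (for $\alpha>1$), then $$P^\star_{Y|X}(y|x)=\frac{\mathbf 1(d(x,y)\le D)}{Q_Y^\star(B_D(x))}\,Q_Y^\star(y)\qquad(x\in\mathcal S)$$ is a well-defined mechanism, satisfies $d(X,Y)\le D$ with probability $1$, and attains $\mathrm{PUT}_\alpha(D)$. For $\alpha>1$ the same mechanism is optimal simultaneously for all $\alpha\in(1,\infty]$ and for every input distribution with support $\mathcal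 S$; that is, it does not depend on $\alpha$, nor on $P_X$ except through its support. -/

import Mathlib

open Filter Topology
open scoped ENNReal

namespace AlphaLeak

noncomputable section

/-- The law `P_{UY}(u, y) = ∑ₓ P_X(x) P_{U|X}(u|x) P_{Y|X}(y|x)` of `(U, Y)`
under the Markov chain `U - X - Y` with input law `P`, `P_{U|X} = V`, `P_{Y|X} = W`. -/
def jointUY {X Y U : Type*} [Fintype X] (P : PMF X) (W : X → PMF Y) (V : X → PMF U)
    (u : U) (y : Y) : ℝ≥0∞ :=
  ∑ x, P x * V x u * W x y

/-- The law `P_U(u) = ∑ₓ P_X(x) P_{U|X}(u|x)` of `U`. -/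
def margU {X U : Type*} [Fintype X] (P : PMF X) (V : X → PMF U) (u : U) : ℝ≥0∞ :=
  ∑ x, P x * V x u

/-- `max_{P_{Û|Y}} 𝔼[ℙ(U = Û | U, Y) ^ ((a - 1) / a)]`: the best expected gain of an adversary
who observes `Y`. -/
def gainObserving {X Y U : Type*} [Fintype X] [Fintype Y] [Fintype U]
    (a : ℝ) (P : PMF X) (W : X → PMF Y) (V : X → PMF U) : ℝ≥0∞ :=
  ⨆ G : Y → PMF U, ∑ u, ∑ y, jointUY P W V u y * (G y u) ^ ((a - 1) / a)

/-- `max_{P_Û} 𝔼[ℙ(U = Û | U) ^ ((a - 1) / a)]`: the best expected gain without any observation. -/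
def gainBlind {X U : Type*} [Fintype X] [Fintype U]
    (a : ℝ) (P : PMF X) (V : X → PMF U) : ℝ≥0∞ :=
  ⨆ G : PMF U, ∑ u, margU P V u * (G u) ^ ((a - 1) / a)

/-- `a / (a - 1) * log (gain with observation / gain without)`, for `a` in `(1, ∞)`. -/
def logGainRatio {X Y U : Type*} [Fintype X] [Fintype Y] [Fintype U]
    (a : ℝ) (P : PMF X) (W : X → PMF Y) (V : X → PMF U) : EReal :=
  ((a / (a - 1) : ℝ) : EReal) * ENNReal.log (gainObserving a P W V / gainBlind a P V)

/-- The filter of `α' → α` with `α'` in `(1, ∞)` and `α' ≠ α`, for `α` in `[1, ∞]`. -/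
def orderFilter (α : ℝ≥0∞) : Filter ℝ≥0∞ :=
  𝓝[Set.Ioo 1 ⊤ \ {α}] α

/-- Maximal `α`-leakage `sup_{U - X - Y} lim_{α' → α} α'/(α'-1) log (...)` from `X` to `Y`,
where `U` is a (possibly randomized) function of `X` with an arbitrary finite alphabet
(represented, up to a bijection, by `Fin n`). -/
def maxAlphaLeakage {X Y : Type*} [Fintype X] [Fintype Y]
    (α : ℝ≥0∞) (P : PMF X) (W : X → PMF Y) : EReal :=
  ⨆ (n : ℕ) (V : X → PMF (Fin n)),
    limUnder (orderFilter α) (fun α' : ℝ≥0∞ => logGainRatio α'.toReal P W V)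

/-- The ball `B_D(x) = {y : d(x, y) ≤ D}`. -/
def ball {X Y : Type*} (d : X → Y → ℝ) (D : ℝ) (x : X) : Set Y :=
  {y | d x y ≤ D}

/-- `Q_Y(B_D(x))`. -/
def ballProb {X Y : Type*} (d : X → Y → ℝ) (D : ℝ) (Q : PMF Y) (x : X) : ℝ≥0∞ :=
  Q.toOuterMeasure (ball d D x)

/-- The hard distortion constraint: `d(X, Y) ≤ D` with probability one when `X` has law `P`
and `P_{Y|X} = W`. -/
def HardDistortion {X Y : Type*} (d : X → Y → ℝ) (D : ℝ) (P : PMF X) (W : X → PMF Y) : Prop :=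
  ∀ x ∈ P.support, ∀ y ∈ (W x).support, d x y ≤ D

/-- The optimal privacy-utility tradeoff: the infimum of the maximal `α`-leakage over all
mechanisms that satisfy the hard distortion constraint. -/
def hardPUT {X Y : Type*} [Fintype X] [Fintype Y]
    (α : ℝ≥0∞) (d : X → Y → ℝ) (D : ℝ) (P : PMF X) : EReal :=
  ⨅ (W : X → PMF Y) (_ : HardDistortion d D P W), maxAlphaLeakage α P W

/-- A mechanism is optimal if it is feasible and attains the infimum `hardPUT`. -/
def IsOptimalMechanism {X Y : Type*} [Fintype X] [Fintype Y]
    (α : ℝ≥0∞) (d : X → Y → ℝ) (D : ℝ) (P : PMF X) (W : X → PMF Y) : Prop :=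
  HardDistortion d D P W ∧ maxAlphaLeakage α P W = hardPUT α d D P

/-- `𝔼[log (1 / Q_Y(B_D(X)))]`, a value in `[0, ∞]`. -/
def expLogInvBall {X Y : Type*} [Fintype X]
    (d : X → Y → ℝ) (D : ℝ) (P : PMF X) (Q : PMF Y) : EReal :=
  ∑ x, (P x : EReal) * ENNReal.log (1 / ballProb d D Q x)

/-- `inf_x Q_Y(B_D(x))`, where `x` ranges over the support `S` of the input. -/
def minBallProb {X Y : Type*} (d : X → Y → ℝ) (D : ℝ) (S : Set X) (Q : PMF Y) : ℝ≥0∞ :=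
  ⨅ x ∈ S, ballProb d D Q x

/-- `q⋆ = sup_{Q_Y} inf_x Q_Y(B_D(x))`, where `x` ranges over the support `S` of the input. -/
def qStar {X Y : Type*} (d : X → Y → ℝ) (D : ℝ) (S : Set X) : ℝ≥0∞ :=
  ⨆ Q : PMF Y, minBallProb d D S Q

/-- `W` is the mechanism given by `dP_{Y|X=x}/dQ (y) = 1(d(x, y) ≤ D) / Q(B_D(x))` for every
possible input `x` (that is, every `x` in the support `S` of the input). -/
def IsBallRestriction {X Y : Type*} (d : X → Y → ℝ) (D : ℝ) (S : Set X) (Q : PMF Y)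
    (W : X → PMF Y) : Prop :=
  ∀ x ∈ S, ∀ y, W x y = (ball d D x).indicator (fun _ => 1 / ballProb d D Q x) y * Q y

end

end AlphaLeak

open AlphaLeak

namespace AlphaLeak

/-! Write `θ = (a - 1) / a`. By Hölder's inequality and its equality case, the best gains are `ℓ^a`
norms: `∑ y, ‖P_{UY}(·, y)‖_a` with the observation and `‖P_U‖_a` without it (`gainObserving_eq`,
`gainBlind_eq`). All limits in the order are then limits of explicit real functions: a derivative at
`1`, which gives the mutual information `I(U; Y)`, continuity at finite orders above `1`, and maxima
at infinity.

Order one. If `W` is `Q` conditioned on the balls, then `I(U; Y) ≤ 𝔼[-log Q(B_D(X))]` for every `U`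
(`mutualInfo_le_of_mul_eq`). Conversely, for any feasible `W` take `U = X` and let `Q` be the law of
`Y`. Each row `W x` lives on `B_D(x)`, so its divergence from `Q` is at least `-log Q(B_D(x))`
(`le_mutualInfo_pure`).

Orders above one, upper bound. The same mechanism has density at most `r = 1 / min_x Q(B_D(x))` with
respect to `Q`. A blind adversary can draw a fake `y` from `Q` and guess as if it had been observed;
by Jensen's inequality this loses at most a factor `r ^ θ`, whatever `U` and the order are
(`IsBallRestriction.gainObserving_le`).

Orders above one, lower bound. `q⋆` is the value of the matrix game with payoff `1(d(x, y) ≤ D)`, so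
by minimax, for each `s > q⋆`, some positive `π` on the support gives each set `{x : d(x, y) ≤ D}`
mass at most `s`. Let `U` consist of `x` and a uniform label in `Fin (m x)`. The sizes `m x` are
chosen to make the best blind guess nearly `π` followed by a uniform label. On seeing `y`, only `x`
with `d(x, y) ≤ D` are possible; restricting `π` to these and renormalizing gains a factor `s ^
(-θ)`, hence leakage close to `-log s` (`log_ratio_ge_of_split`,
`HardDistortion.neg_log_sub_le_maxAlphaLeakage`).

Attainment is compactness of the simplex. -/

/-- The `ℓ^a` norm `(∑ fᵢ ^ a) ^ (1 / a)` of a nonnegative finite family. -/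
noncomputable def powNorm {ι : Type*} [Fintype ι] (a : ℝ) (f : ι → ℝ) : ℝ :=
  (∑ i, f i ^ a) ^ (1 / a)

theorem nonempty_of_pmf {Z : Type*} (G : PMF Z) : Nonempty Z :=
  let ⟨u, _⟩ := G.support_nonempty
  ⟨u⟩

theorem nonempty_of_channel {X U : Type*} [Nonempty X] (V : X → PMF U) : Nonempty U :=
  nonempty_of_pmf (V (Classical.arbitrary X))

/-! ### Optimal guessing: Hölder's inequality and its equality case -/

section Gain

variable {U : Type*} [Fintype U]

/-- Hölder with exponents `a` and `a / (a - 1)`: the second is the inverse of `(a - 1) / a`, so the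
power of `g` disappears. -/
theorem ennreal_sum_mul_rpow_le {a : ℝ} (ha : 1 < a) (c : U → ℝ≥0∞) (g : U → ℝ≥0∞) :
    ∑ u, c u * g u ^ ((a - 1) / a) ≤ (∑ u, c u ^ a) ^ (1 / a) * (∑ u, g u) ^ ((a - 1) / a) := by
  have h := ENNReal.inner_le_Lp_mul_Lq Finset.univ c (fun u => g u ^ ((a - 1) / a))
    (Real.HolderConjugate.conjExponent ha)
  have hq : (a - 1) / a * Real.conjExponent a = 1 := by
    have : a - 1 ≠ 0 := by linarith
    have : a ≠ 0 := by linarith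
    rw [Real.conjExponent]; field_simp
  have hq' : 1 / Real.conjExponent a = (a - 1) / a := by
    rw [Real.conjExponent, one_div_div]
  simpa only [← ENNReal.rpow_mul, hq, hq', ENNReal.rpow_one] using h

/-- The equality case of Hölder: guess `u` with probability proportional to `c u ^ a`. If all
weights vanish there is nothing to normalize, and any guess will do. -/
theorem exists_pmf_gain_eq [Nonempty U] {a : ℝ} (ha : 1 < a) (c : U → ℝ≥0∞)
    (hc : ∀ u, c u ≠ ⊤) :
    ∃ G : PMF U, ∑ u, c u * G u ^ ((a - 1) / a) = (∑ u, c u ^ a) ^ (1 / a) := by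
  have ha0 : 0 < a := by linarith
  have hθ : 0 < (a - 1) / a := div_pos (by linarith) ha0
  set T := ∑ u, c u ^ a with hT
  have hTtop : T ≠ ⊤ := by
    rw [hT, ENNReal.sum_ne_top]
    exact fun u _ => ENNReal.rpow_ne_top_of_nonneg ha0.le (hc u)
  by_cases hT0 : T = 0
  · have hz : ∀ u, c u = 0 := by
      intro u
      have := (Finset.sum_eq_zero_iff.mp (hT ▸ hT0)) u (Finset.mem_univ u)
      exact (ENNReal.rpow_eq_zero_iff_of_pos ha0).mp this
    refine ⟨PMF.pure (Classical.arbitrary U), ?_⟩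
    rw [hT0, ENNReal.zero_rpow_of_pos (by positivity)]
    simp [hz]
  · refine ⟨PMF.ofFintype (fun u => c u ^ a * T⁻¹) ?_, ?_⟩
    · rw [← Finset.sum_mul, ← hT, ENNReal.mul_inv_cancel hT0 hTtop]
    · have key : ∀ u, c u * (c u ^ a * T⁻¹) ^ ((a - 1) / a) =
          c u ^ a * T⁻¹ ^ ((a - 1) / a) := by
        intro u
        rw [ENNReal.mul_rpow_of_nonneg _ _ hθ.le, ← mul_assoc, ← ENNReal.rpow_mul,
          mul_div_cancel₀ _ ha0.ne']
        congr 1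
        by_cases h0 : c u = 0
        · simp [h0, ha0]
        · nth_rewrite 1 [← ENNReal.rpow_one (c u)]
          rw [← ENNReal.rpow_add _ _ h0 (hc u)]
          congr 1; ring
      simp only [PMF.ofFintype_apply, key]
      rw [← Finset.sum_mul, ← hT, ENNReal.inv_rpow, ← ENNReal.rpow_neg]
      nth_rewrite 1 [← ENNReal.rpow_one T]
      rw [← ENNReal.rpow_add _ _ hT0 hTtop]
      congr 1; field_simp; ring

theorem sum_pmf_coe (G : PMF U) : ∑ u, G u = 1 := by
  rw [← tsum_fintype (L := SummationFilter.unconditional U), G.tsum_coe]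

theorem gain_le {a : ℝ} (ha : 1 < a) (c : U → ℝ≥0∞) (G : PMF U) :
    ∑ u, c u * G u ^ ((a - 1) / a) ≤ (∑ u, c u ^ a) ^ (1 / a) := by
  simpa [sum_pmf_coe] using ennreal_sum_mul_rpow_le ha c G

theorem toReal_ennreal_powNorm {a : ℝ} (ha : 1 < a) (c : U → ℝ≥0∞) (hc : ∀ u, c u ≠ ⊤) :
    ((∑ u, c u ^ a) ^ (1 / a)).toReal = powNorm a (fun u => (c u).toReal) := by
  have ha0 : 0 < a := by linarith
  rw [← ENNReal.toReal_rpow, ENNReal.toReal_sum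
    (fun u _ => ENNReal.rpow_ne_top_of_nonneg ha0.le (hc u))]
  simp only [← ENNReal.toReal_rpow, powNorm]

theorem powNorm_nonneg {a : ℝ} {f : U → ℝ} (hf : ∀ u, 0 ≤ f u) : 0 ≤ powNorm a f :=
  Real.rpow_nonneg (Finset.sum_nonneg fun u _ => Real.rpow_nonneg (hf u) _) _

theorem powNorm_pos {a : ℝ} {f : U → ℝ} (hf : ∀ u, 0 ≤ f u) {u : U} (hu : 0 < f u) :
    0 < powNorm a f :=
  Real.rpow_pos_of_pos (Finset.sum_pos' (fun u _ => Real.rpow_nonneg (hf u) _)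
    ⟨u, Finset.mem_univ u, Real.rpow_pos_of_pos hu _⟩) _

end Gain

/-! ### Closed forms of the gains, with real values -/

section Real

variable {X Y U : Type*} [Fintype X] (P : PMF X) (W : X → PMF Y) (V : X → PMF U)

/-- The law of `(U, Y)`, with real values. -/
noncomputable def jointReal (u : U) (y : Y) : ℝ := ∑ x, (P x).toReal * (V x u).toReal * (W x y).toReal

/-- The law of `U`, with real values. -/
noncomputable def margReal (u : U) : ℝ := ∑ x, (P x).toReal * (V x u).toReal

theorem jointUY_ne_top (u : U) (y : Y) : jointUY P W V u y ≠ ⊤ := by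
  rw [jointUY, ENNReal.sum_ne_top]
  exact fun x _ => ENNReal.mul_ne_top (ENNReal.mul_ne_top (P.apply_ne_top x)
    ((V x).apply_ne_top u)) ((W x).apply_ne_top y)

theorem margU_ne_top (u : U) : margU P V u ≠ ⊤ := by
  rw [margU, ENNReal.sum_ne_top]
  exact fun x _ => ENNReal.mul_ne_top (P.apply_ne_top x) ((V x).apply_ne_top u)

theorem toReal_jointUY (u : U) (y : Y) : (jointUY P W V u y).toReal = jointReal P W V u y := by
  rw [jointUY, ENNReal.toReal_sum fun x _ => ENNReal.mul_ne_top (ENNReal.mul_ne_top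
    (P.apply_ne_top x) ((V x).apply_ne_top u)) ((W x).apply_ne_top y)]
  simp [jointReal]

theorem toReal_margU (u : U) : (margU P V u).toReal = margReal P V u := by
  rw [margU, ENNReal.toReal_sum fun x _ => ENNReal.mul_ne_top
    (P.apply_ne_top x) ((V x).apply_ne_top u)]
  simp [margReal]

theorem jointReal_nonneg (u : U) (y : Y) : 0 ≤ jointReal P W V u y :=
  Finset.sum_nonneg fun _ _ => by positivity

theorem margReal_nonneg (u : U) : 0 ≤ margReal P V u :=
  Finset.sum_nonneg fun _ _ => by positivity

theorem sum_toReal_pmf {Z : Type*} [Fintype Z] (G : PMF Z) : ∑ z, (G z).toReal = 1 := by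
  rw [← ENNReal.toReal_sum fun z _ => G.apply_ne_top z, sum_pmf_coe, ENNReal.toReal_one]

theorem sum_jointReal [Fintype Y] (u : U) : ∑ y, jointReal P W V u y = margReal P V u := by
  simp only [jointReal, margReal]
  rw [Finset.sum_comm]
  simp [← Finset.mul_sum, sum_toReal_pmf]

theorem sum_margReal [Fintype U] : ∑ u, margReal P V u = 1 := by
  simp only [margReal]
  rw [Finset.sum_comm]
  simp [← Finset.mul_sum, sum_toReal_pmf]

variable [Fintype Y] [Fintype U]

theorem gainBlind_eq {a : ℝ} (ha : 1 < a) :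
    gainBlind a P V = (∑ u, margU P V u ^ a) ^ (1 / a) := by
  have := nonempty_of_pmf P
  have := nonempty_of_channel V
  refine le_antisymm (iSup_le fun G => gain_le ha _ G) ?_
  obtain ⟨G, hG⟩ := exists_pmf_gain_eq ha _ (margU_ne_top P V)
  exact hG ▸ le_iSup (fun G : PMF U => ∑ u, margU P V u * (G u) ^ ((a - 1) / a)) G

theorem gainObserving_eq {a : ℝ} (ha : 1 < a) :
    gainObserving a P W V = ∑ y, (∑ u, jointUY P W V u y ^ a) ^ (1 / a) := by
  have := nonempty_of_pmf P
  have := nonempty_of_channel V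
  refine le_antisymm (iSup_le fun G => ?_) ?_
  · rw [Finset.sum_comm]
    exact Finset.sum_le_sum fun y _ => gain_le ha _ (G y)
  · choose G hG using fun y => exists_pmf_gain_eq ha _ (fun u => jointUY_ne_top P W V u y)
    simp only [← hG]
    rw [Finset.sum_comm]
    exact le_iSup (fun G : Y → PMF U => ∑ u, ∑ y, jointUY P W V u y * (G y u) ^ ((a - 1) / a)) G

/-- The best expected gain with an observation, in closed form. -/
noncomputable def obsReal (a : ℝ) : ℝ := ∑ y, powNorm a (fun u => jointReal P W V u y)

/-- The best expected gain without observation, in closed form. -/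
noncomputable def blindReal (a : ℝ) : ℝ := powNorm a (margReal P V)

theorem gainBlind_ne_top {a : ℝ} (ha : 1 < a) : gainBlind a P V ≠ ⊤ := by
  have ha0 : 0 < a := by linarith
  rw [gainBlind_eq P V ha]
  refine ENNReal.rpow_ne_top_of_nonneg (by positivity) ?_
  rw [ENNReal.sum_ne_top]
  exact fun u _ => ENNReal.rpow_ne_top_of_nonneg ha0.le (margU_ne_top P V u)

theorem gainObserving_ne_top {a : ℝ} (ha : 1 < a) : gainObserving a P W V ≠ ⊤ := by
  have ha0 : 0 < a := by linarith
  rw [gainObserving_eq P W V ha, ENNReal.sum_ne_top]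
  intro y _
  refine ENNReal.rpow_ne_top_of_nonneg (by positivity) ?_
  rw [ENNReal.sum_ne_top]
  exact fun u _ => ENNReal.rpow_ne_top_of_nonneg ha0.le (jointUY_ne_top P W V u y)

theorem toReal_gainBlind {a : ℝ} (ha : 1 < a) : (gainBlind a P V).toReal = blindReal P V a := by
  rw [gainBlind_eq P V ha, toReal_ennreal_powNorm ha _ (margU_ne_top P V)]
  simp only [toReal_margU]; rfl

theorem toReal_gainObserving {a : ℝ} (ha : 1 < a) :
    (gainObserving a P W V).toReal = obsReal P W V a := by
  have ha0 : 0 < a := by linarith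
  rw [gainObserving_eq P W V ha, ENNReal.toReal_sum]
  · simp only [toReal_ennreal_powNorm ha _ (fun u => jointUY_ne_top P W V u _), toReal_jointUY]
    rfl
  · intro y _
    refine ENNReal.rpow_ne_top_of_nonneg (by positivity) ?_
    rw [ENNReal.sum_ne_top]
    exact fun u _ => ENNReal.rpow_ne_top_of_nonneg ha0.le (jointUY_ne_top P W V u y)

theorem exists_margReal_pos : ∃ u, 0 < margReal P V u := by
  by_contra! h
  have := Finset.sum_nonpos (s := Finset.univ) fun u _ => h u
  rw [sum_margReal] at this
  linarith

theorem exists_jointReal_pos : ∃ y u, 0 < jointReal P W V u y := by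
  obtain ⟨u, hu⟩ := exists_margReal_pos P V
  by_contra! h
  have := Finset.sum_nonpos (s := Finset.univ) fun y _ => h y u
  rw [sum_jointReal] at this
  linarith

theorem blindReal_pos (a : ℝ) : 0 < blindReal P V a :=
  let ⟨_, hu⟩ := exists_margReal_pos P V
  powNorm_pos (margReal_nonneg P V) hu

theorem obsReal_pos (a : ℝ) : 0 < obsReal P W V a := by
  obtain ⟨y, u, hu⟩ := exists_jointReal_pos P W V
  exact Finset.sum_pos' (fun y _ => powNorm_nonneg (fun u => jointReal_nonneg P W V u y))
    ⟨y, Finset.mem_univ y, powNorm_pos (fun u => jointReal_nonneg P W V u y) hu⟩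

/-- `a / (a - 1) * log (gain ratio)`, in closed form with real values. -/
noncomputable def logRatioReal (a : ℝ) : ℝ :=
  a / (a - 1) * (Real.log (obsReal P W V a) - Real.log (blindReal P V a))

/-- Both gains are finite and positive, so the extended logarithm is an ordinary one and the limits
can be computed in `ℝ`. -/
theorem logGainRatio_eq {a : ℝ} (ha : 1 < a) :
    logGainRatio a P W V = (logRatioReal P W V a : EReal) := by
  have hb := blindReal_pos P V a
  have ho := obsReal_pos P W V a
  have hr : gainObserving a P W V / gainBlind a P V
      = ENNReal.ofReal (obsReal P W V a / blindReal P V a) := by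
    rw [ENNReal.ofReal_div_of_pos hb, ← toReal_gainBlind P V ha, ← toReal_gainObserving P W V ha,
      ENNReal.ofReal_toReal (gainBlind_ne_top P V ha),
      ENNReal.ofReal_toReal (gainObserving_ne_top P W V ha)]
  rw [logGainRatio, hr, ENNReal.log_ofReal_of_pos (by positivity), Real.log_div ho.ne' hb.ne',
    logRatioReal, EReal.coe_mul]

end Real

/-! ### The filter of orders tending to `α` -/

section OrderFilter

/-- Uniqueness of limits, and with it the meaning of `limUnder`, needs a nontrivial filter. A finite
`α` is approached from above, `⊤` from below. -/
theorem orderFilter_neBot {α : ℝ≥0∞} (hα : 1 ≤ α) : (orderFilter α).NeBot := by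
  rcases eq_or_ne α ⊤ with rfl | hne
  · have h : Set.Ioo (1 : ℝ≥0∞) ⊤ \ {⊤} = Set.Ioo 1 ⊤ := by
      ext x; simp +contextual
    rw [orderFilter, h, nhdsWithin_Ioo_eq_nhdsLT ENNReal.one_lt_top]
    exact nhdsLT_neBot_of_exists_lt ⟨1, ENNReal.one_lt_top⟩
  · have hlt : α < ⊤ := hne.lt_top
    have h : Set.Ioo α ⊤ ⊆ Set.Ioo (1 : ℝ≥0∞) ⊤ \ {α} := fun x hx =>
      ⟨⟨hα.trans_lt hx.1, hx.2⟩, hx.1.ne'⟩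
    have h2 : (𝓝[Set.Ioo α ⊤] α).NeBot := by
      rw [nhdsWithin_Ioo_eq_nhdsGT hlt]
      exact nhdsGT_neBot_of_exists_gt ⟨⊤, hlt⟩
    exact h2.mono (nhdsWithin_mono _ h)

theorem eventually_orderFilter (α : ℝ≥0∞) : ∀ᶠ b in orderFilter α, 1 < b ∧ b ≠ ⊤ ∧ b ≠ α :=
  eventually_nhdsWithin_of_forall fun _ hb => ⟨hb.1.1, hb.1.2.ne, hb.2⟩

theorem one_lt_toReal {b : ℝ≥0∞} (h1 : 1 < b) (h2 : b ≠ ⊤) : 1 < b.toReal := by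
  simpa using (ENNReal.toReal_lt_toReal ENNReal.one_ne_top h2).2 h1

theorem eventually_one_lt_toReal (α : ℝ≥0∞) : ∀ᶠ b in orderFilter α, 1 < b.toReal := by
  filter_upwards [eventually_orderFilter α] with b hb using one_lt_toReal hb.1 hb.2.1

theorem tendsto_toReal_orderFilter {α : ℝ≥0∞} (hα : α ≠ ⊤) :
    Tendsto ENNReal.toReal (orderFilter α) (𝓝[≠] α.toReal) := by
  refine tendsto_nhdsWithin_iff.2 ⟨(ENNReal.tendsto_toReal hα).mono_left nhdsWithin_le_nhds, ?_⟩
  filter_upwards [eventually_orderFilter α] with b hb h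
  exact hb.2.2 ((ENNReal.toReal_eq_toReal_iff' hb.2.1 hα).1 h)

theorem tendsto_toReal_orderFilter_top : Tendsto ENNReal.toReal (orderFilter ⊤) atTop := by
  refine tendsto_atTop.2 fun r => ?_
  have h : ∀ᶠ b : ℝ≥0∞ in orderFilter ⊤, ENNReal.ofReal r < b :=
    (lt_mem_nhds ENNReal.ofReal_lt_top).filter_mono nhdsWithin_le_nhds
  filter_upwards [h, eventually_orderFilter ⊤] with b hb hb'
  exact (ENNReal.ofReal_le_iff_le_toReal hb'.2.1).1 hb.le

/-- Written as `1 - 1 / α`, the limit of the exponent covers finite and infinite orders at once. -/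
theorem tendsto_sub_one_div_toReal {α : ℝ≥0∞} (hα : α ≠ 0) :
    Tendsto (fun b : ℝ≥0∞ => (b.toReal - 1) / b.toReal) (orderFilter α)
      (𝓝 (1 - (α⁻¹).toReal)) := by
  have h : Tendsto (fun b : ℝ≥0∞ => 1 - (b⁻¹).toReal) (orderFilter α) (𝓝 (1 - (α⁻¹).toReal)) :=
    (((ENNReal.tendsto_toReal (ENNReal.inv_ne_top.2 hα)).comp
      (continuous_inv.tendsto α)).const_sub 1).mono_left nhdsWithin_le_nhds
  refine h.congr' ?_
  filter_upwards [eventually_one_lt_toReal α] with b hb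
  rw [ENNReal.toReal_inv]
  field_simp

end OrderFilter

/-! ### The `ℓ^a` norm as a function of `a` -/

section PowNorm

variable {ι : Type*} [Fintype ι] {f : ι → ℝ}

theorem continuousAt_powNorm {a : ℝ} (ha : 0 < a) :
    ContinuousAt (fun b => powNorm b f) a := by
  refine ContinuousAt.rpow ?_ (continuousAt_const.div continuousAt_id ha.ne')
    (Or.inr (by positivity))
  refine tendsto_finsetSum _ fun i _ => ?_
  exact ContinuousAt.rpow continuousAt_const continuousAt_id (Or.inr ha)

theorem le_powNorm (hf : ∀ i, 0 ≤ f i) {a : ℝ} (ha : 0 < a) (i : ι) : f i ≤ powNorm a f := by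
  have h : f i = (f i ^ a) ^ (1 / a) := by
    rw [← Real.rpow_mul (hf i), mul_one_div_cancel ha.ne', Real.rpow_one]
  rw [h]
  exact Real.rpow_le_rpow (Real.rpow_nonneg (hf i) _) (Finset.single_le_sum
    (f := fun i => f i ^ a) (fun i _ => Real.rpow_nonneg (hf i) _) (Finset.mem_univ i))
    (by positivity)

/-- Squeeze between the maximum and `card ^ (1 / a)` times the maximum. -/
theorem tendsto_powNorm_atTop (hf : ∀ i, 0 ≤ f i) {i : ι} (hi : ∀ j, f j ≤ f i) :
    Tendsto (fun a => powNorm a f) atTop (𝓝 (f i)) := by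
  have hc : (0 : ℝ) < Fintype.card ι := by exact_mod_cast Fintype.card_pos_iff.2 ⟨i⟩
  have h1 : Tendsto (fun a : ℝ => (Fintype.card ι : ℝ) ^ (1 / a) * f i) atTop (𝓝 (f i)) := by
    have : Tendsto (fun a : ℝ => (Fintype.card ι : ℝ) ^ (1 / a)) atTop (𝓝 1) := by
      have h0 : Tendsto (fun a : ℝ => 1 / a) atTop (𝓝 0) := by
        simpa using tendsto_inv_atTop_zero (𝕜 := ℝ)
      simpa [Function.comp_def] using (Real.continuousAt_const_rpow hc.ne').tendsto.comp h0
    simpa using this.mul_const (f i)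
  refine tendsto_of_tendsto_of_tendsto_of_le_of_le' tendsto_const_nhds h1 ?_ ?_
  · filter_upwards [eventually_gt_atTop 0] with a ha using le_powNorm hf ha i
  · filter_upwards [eventually_gt_atTop 0] with a ha
    have h : f i = (f i ^ a) ^ (1 / a) := by
      rw [← Real.rpow_mul (hf i), mul_one_div_cancel ha.ne', Real.rpow_one]
    rw [h]
    rw [← Real.mul_rpow hc.le (Real.rpow_nonneg (hf i) _)]
    refine Real.rpow_le_rpow (Finset.sum_nonneg fun j _ => Real.rpow_nonneg (hf j) _) ?_
      (by positivity)
    calc ∑ j, f j ^ a ≤ ∑ _j : ι, f i ^ a :=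
          Finset.sum_le_sum fun j _ => Real.rpow_le_rpow (hf j) (hi j) ha.le
      _ = Fintype.card ι * f i ^ a := by simp

/-- This is where entropy enters: the derivative at `1` is a negative, unnormalized entropy. Zero
entries are treated apart, being constant in `a` near `1`. -/
theorem hasDerivAt_powNorm_one (hf : ∀ i, 0 ≤ f i) :
    HasDerivAt (fun a => powNorm a f)
      (∑ i, f i * Real.log (f i) - (∑ i, f i) * Real.log (∑ i, f i)) 1 := by
  rcases (Finset.sum_nonneg fun i _ => hf i : 0 ≤ ∑ i, f i).eq_or_lt with h0 | hpos
  · have hz : ∀ i, f i = 0 := fun i =>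
      (Finset.sum_eq_zero_iff_of_nonneg fun i _ => hf i).1 h0.symm i (Finset.mem_univ i)
    simp only [hz, zero_mul, Finset.sum_const_zero, sub_zero]
    refine (hasDerivAt_const (1 : ℝ) (0 : ℝ)).congr_of_eventuallyEq ?_
    filter_upwards [eventually_gt_nhds (zero_lt_one' ℝ)] with a ha
    simp [powNorm, hz, Real.zero_rpow ha.ne', ha.ne']
  · have hi : ∀ i, HasDerivAt (fun a : ℝ => f i ^ a) (f i * Real.log (f i)) 1 := by
      intro i
      rcases (hf i).eq_or_lt with h | h
      · rw [← h, zero_mul]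
        refine (hasDerivAt_const (1 : ℝ) (0 : ℝ)).congr_of_eventuallyEq ?_
        filter_upwards [eventually_gt_nhds (zero_lt_one' ℝ)] with a ha
        exact Real.zero_rpow ha.ne'
      · simpa using (Real.hasStrictDerivAt_const_rpow h 1).hasDerivAt
    have hs : HasDerivAt (fun a : ℝ => ∑ i, f i ^ a) (∑ i, f i * Real.log (f i)) 1 :=
      HasDerivAt.fun_sum fun i _ => hi i
    have hinv : HasDerivAt (fun a : ℝ => 1 / a) (-1) 1 := by
      simpa using (hasDerivAt_inv (one_ne_zero (α := ℝ)))
    have := hs.rpow hinv (by simpa using hpos)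
    refine (this : HasDerivAt (fun a => powNorm a f) _ 1).congr_deriv ?_
    simp only [Real.rpow_one, div_one, sub_self, Real.rpow_zero]
    ring

end PowNorm

/-! ### Existence of the limits, and bounds on the maximal leakage -/

section Limit

variable {X Y U : Type*} [Fintype X] [Fintype Y] [Fintype U]
  (P : PMF X) (W : X → PMF Y) (V : X → PMF U)

/-- The law of `Y`, with real values, as the marginal of the law of `(U, Y)`. -/
noncomputable def outReal (y : Y) : ℝ := ∑ u, jointReal P W V u y

/-- The mutual information between `U` and `Y`, as a combination of entropies. -/
noncomputable def mutualInfo : ℝ :=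
  ∑ y, ∑ u, jointReal P W V u y * Real.log (jointReal P W V u y)
    - ∑ y, outReal P W V y * Real.log (outReal P W V y)
    - ∑ u, margReal P V u * Real.log (margReal P V u)

theorem sum_outReal : ∑ y, outReal P W V y = 1 := by
  simp only [outReal]
  rw [Finset.sum_comm]
  simp [sum_jointReal, sum_margReal]

theorem obsReal_one : obsReal P W V 1 = 1 := by
  simpa [obsReal, powNorm, outReal] using sum_outReal P W V

theorem blindReal_one : blindReal P V 1 = 1 := by
  simpa [blindReal, powNorm] using sum_margReal P V

/-- Both gains equal `1` at order `1`, so the expression is `a` times the slope at `1` of a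
difference of logarithms. -/
theorem tendsto_logRatioReal_one :
    Tendsto (logRatioReal P W V) (𝓝[≠] 1) (𝓝 (mutualInfo P W V)) := by
  have ho : HasDerivAt (obsReal P W V)
      (∑ y, (∑ u, jointReal P W V u y * Real.log (jointReal P W V u y)
        - outReal P W V y * Real.log (outReal P W V y))) 1 :=
    HasDerivAt.fun_sum fun y _ => hasDerivAt_powNorm_one fun u => jointReal_nonneg P W V u y
  have hb : HasDerivAt (blindReal P V) (∑ u, margReal P V u * Real.log (margReal P V u)) 1 := by
    have := hasDerivAt_powNorm_one (margReal_nonneg P V)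
    rwa [sum_margReal, Real.log_one, mul_zero, sub_zero] at this
  have h := (ho.log (obsReal_pos P W V 1).ne').fun_sub (hb.log (blindReal_pos P V 1).ne')
  rw [obsReal_one, blindReal_one, div_one, div_one, Finset.sum_sub_distrib] at h
  rw [hasDerivAt_iff_tendsto_slope] at h
  have h2 : Tendsto (fun a : ℝ => a) (𝓝[≠] 1) (𝓝 1) := tendsto_id.mono_left nhdsWithin_le_nhds
  have h3 := h2.mul h
  rw [one_mul] at h3
  refine h3.congr fun a => ?_
  rw [slope_def_field, obsReal_one, blindReal_one, logRatioReal]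
  simp
  ring

theorem tendsto_logRatioReal_of_pos {a : ℝ} (ha : 1 < a) :
    Tendsto (logRatioReal P W V) (𝓝 a) (𝓝 (logRatioReal P W V a)) := by
  have ha0 : 0 < a := by linarith
  refine ContinuousAt.tendsto ?_
  refine ContinuousAt.mul (continuousAt_id.div (continuousAt_id.sub continuousAt_const)
    (by simpa using sub_ne_zero.2 ha.ne')) (ContinuousAt.sub ?_ ?_)
  · refine ContinuousAt.log ?_ (obsReal_pos P W V a).ne'
    exact tendsto_finsetSum _ fun y _ => continuousAt_powNorm ha0
  · exact (continuousAt_powNorm ha0).log (blindReal_pos P V a).ne'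

theorem exists_tendsto_logRatioReal_atTop :
    ∃ L : ℝ, Tendsto (logRatioReal P W V) atTop (𝓝 L) := by
  have := nonempty_of_pmf P
  have := nonempty_of_channel V
  choose m hm using fun y => Finite.exists_max fun u => jointReal P W V u y
  obtain ⟨k, hk⟩ := Finite.exists_max (margReal P V)
  have ho : Tendsto (obsReal P W V) atTop (𝓝 (∑ y, jointReal P W V (m y) y)) :=
    tendsto_finsetSum _ fun y _ =>
      tendsto_powNorm_atTop (fun u => jointReal_nonneg P W V u y) (hm y)
  have hb : Tendsto (blindReal P V) atTop (𝓝 (margReal P V k)) :=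
    tendsto_powNorm_atTop (margReal_nonneg P V) hk
  have hbpos : 0 < margReal P V k :=
    let ⟨u, hu⟩ := exists_margReal_pos P V
    hu.trans_le (hk u)
  have hopos : 0 < ∑ y, jointReal P W V (m y) y := by
    obtain ⟨y, u, hu⟩ := exists_jointReal_pos P W V
    exact Finset.sum_pos' (fun y _ => jointReal_nonneg P W V _ y)
      ⟨y, Finset.mem_univ y, hu.trans_le (hm y u)⟩
  have hq : Tendsto (fun a : ℝ => a / (a - 1)) atTop (𝓝 1) := by
    have h1 : Tendsto (fun a : ℝ => 1 + (a - 1)⁻¹) atTop (𝓝 1) := by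
      simpa [← sub_eq_add_neg, Function.comp_def] using (tendsto_inv_atTop_zero.comp
        (tendsto_atTop_add_const_right atTop (-1 : ℝ) tendsto_id)).const_add (1 : ℝ)
    refine h1.congr' ?_
    filter_upwards [eventually_gt_atTop 1] with a ha
    have : a - 1 ≠ 0 := by linarith
    field_simp; ring
  exact ⟨_, hq.mul ((ho.log hopos.ne').sub (hb.log hbpos.ne'))⟩

theorem tendsto_logGainRatio {α : ℝ≥0∞} {L : ℝ}
    (h : Tendsto (fun b : ℝ≥0∞ => logRatioReal P W V b.toReal) (orderFilter α) (𝓝 L)) :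
    Tendsto (fun b : ℝ≥0∞ => logGainRatio b.toReal P W V) (orderFilter α) (𝓝 (L : EReal)) := by
  refine ((continuous_coe_real_ereal.tendsto L).comp h).congr' ?_
  filter_upwards [eventually_one_lt_toReal α] with b hb
  exact (logGainRatio_eq P W V hb).symm

theorem tendsto_logGainRatio_one :
    Tendsto (fun b : ℝ≥0∞ => logGainRatio b.toReal P W V) (orderFilter 1)
      (𝓝 (mutualInfo P W V : EReal)) := by
  refine tendsto_logGainRatio P W V ?_
  have := tendsto_toReal_orderFilter ENNReal.one_ne_top
  rw [ENNReal.toReal_one] at this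
  exact (tendsto_logRatioReal_one P W V).comp this

theorem exists_tendsto_logGainRatio {α : ℝ≥0∞} (hα : 1 ≤ α) :
    ∃ L : ℝ, Tendsto (fun b : ℝ≥0∞ => logGainRatio b.toReal P W V) (orderFilter α)
      (𝓝 (L : EReal)) := by
  rcases eq_or_ne α ⊤ with rfl | htop
  · obtain ⟨L, hL⟩ := exists_tendsto_logRatioReal_atTop P W V
    exact ⟨L, tendsto_logGainRatio P W V (hL.comp tendsto_toReal_orderFilter_top)⟩
  rcases hα.eq_or_lt with rfl | hlt
  · exact ⟨_, tendsto_logGainRatio_one P W V⟩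
  · exact ⟨_, tendsto_logGainRatio P W V ((tendsto_logRatioReal_of_pos P W V
      (one_lt_toReal hlt htop)).comp
      ((tendsto_toReal_orderFilter htop).mono_right nhdsWithin_le_nhds))⟩

/-- Relabelling invariance lets `le_maxAlphaLeakage` accept any finite alphabet, although the
supremum runs over the types `Fin n` only. -/
theorem logRatioReal_equiv {U' : Type*} [Fintype U'] (e : U ≃ U') (V' : X → PMF U')
    (h : ∀ x u, V' x (e u) = V x u) : logRatioReal P W V' = logRatioReal P W V := by
  have hj : ∀ u y, jointReal P W V' (e u) y = jointReal P W V u y := by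
    intro u y; simp [jointReal, h]
  have hm : ∀ u, margReal P V' (e u) = margReal P V u := by
    intro u; simp [margReal, h]
  funext a
  have ho : obsReal P W V' a = obsReal P W V a := by
    simp only [obsReal, powNorm, ← hj]
    refine Finset.sum_congr rfl fun y _ => ?_
    rw [e.sum_comp (fun u => jointReal P W V' u y ^ a)]
  have hb : blindReal P V' a = blindReal P V a := by
    simp only [blindReal, powNorm, ← hm]
    rw [e.sum_comp (fun u => margReal P V' u ^ a)]
  rw [logRatioReal, logRatioReal, ho, hb]

theorem le_maxAlphaLeakage {α : ℝ≥0∞} (hα : 1 ≤ α) {L : EReal}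
    (hL : Tendsto (fun b : ℝ≥0∞ => logGainRatio b.toReal P W V) (orderFilter α) (𝓝 L)) :
    L ≤ maxAlphaLeakage α P W := by
  have := orderFilter_neBot hα
  let e := Fintype.equivFin U
  let V' : X → PMF (Fin (Fintype.card U)) := fun x => (V x).map e
  have hV' : ∀ x u, V' x (e u) = V x u := by
    intro x u
    simp only [V', PMF.map_apply, EmbeddingLike.apply_eq_iff_eq]
    rw [tsum_eq_single u (by intro b hb; simp [hb.symm])]
    simp
  have hlim : Tendsto (fun b : ℝ≥0∞ => logGainRatio b.toReal P W V') (orderFilter α) (𝓝 L) := by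
    refine hL.congr' ?_
    filter_upwards [eventually_one_lt_toReal α] with b hb
    rw [logGainRatio_eq _ _ _ hb, logGainRatio_eq _ _ _ hb, logRatioReal_equiv P W V e V' hV']
  rw [← hlim.limUnder_eq]
  exact le_iSup₂ (f := fun (n : ℕ) (V : X → PMF (Fin n)) =>
    limUnder (orderFilter α) (fun b : ℝ≥0∞ => logGainRatio b.toReal P W V)) _ V'

theorem maxAlphaLeakage_le {α : ℝ≥0∞} (hα : 1 ≤ α) {M : EReal}
    (h : ∀ (n : ℕ) (V : X → PMF (Fin n)) (L : EReal),
      Tendsto (fun b : ℝ≥0∞ => logGainRatio b.toReal P W V) (orderFilter α) (𝓝 L) → L ≤ M) :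
    maxAlphaLeakage α P W ≤ M := by
  have := orderFilter_neBot hα
  refine iSup₂_le fun n V => ?_
  obtain ⟨L, hL⟩ := exists_tendsto_logGainRatio P W V hα
  rw [hL.limUnder_eq]
  exact h n V L hL

end Limit

theorem ereal_coe_eq {X : Type*} (P : PMF X) (x : X) : (P x : EReal) = ((P x).toReal : EReal) :=
  (EReal.coe_ennreal_toReal (P.apply_ne_top x)).symm

theorem ereal_coe_sum {ι : Type*} (s : Finset ι) (f : ι → ℝ) :
    ((∑ i ∈ s, f i : ℝ) : EReal) = ∑ i ∈ s, (f i : EReal) :=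
  map_sum (⟨⟨Real.toEReal, EReal.coe_zero⟩, EReal.coe_add⟩ : ℝ →+ EReal) f s

theorem IsBallRestriction.mem_ball {X Y : Type*} {d : X → Y → ℝ} {D : ℝ} {S : Set X} {Q : PMF Y} {W : X → PMF Y}
    (h : IsBallRestriction d D S Q W) {x : X} (hx : x ∈ S) {y : Y} (hy : W x y ≠ 0) :
    y ∈ ball d D x := by
  by_contra hn
  exact hy (by rw [h x hx y, Set.indicator_of_notMem hn, zero_mul])

theorem IsBallRestriction.hardDistortion {X Y : Type*} {d : X → Y → ℝ} {D : ℝ} {P : PMF X} {Q : PMF Y} {W : X → PMF Y}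
    (h : IsBallRestriction d D P.support Q W) : HardDistortion d D P W :=
  fun _ hx _ hy => h.mem_ball hx hy

/-! ### Ball probabilities and the ball-restricted mechanism -/

section Ball

variable {X Y : Type*} [Fintype Y] (d : X → Y → ℝ) (D : ℝ)

theorem ballProb_le_one (Q : PMF Y) (x : X) : ballProb d D Q x ≤ 1 := by
  rw [ballProb, PMF.toOuterMeasure_apply_fintype, ← sum_pmf_coe Q]
  exact Finset.sum_le_sum fun y _ => Set.indicator_le_self _ _ _

theorem ballProb_ne_top (Q : PMF Y) (x : X) : ballProb d D Q x ≠ ⊤ :=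
  ((ballProb_le_one d D Q x).trans_lt ENNReal.one_lt_top).ne

open Classical in
theorem toReal_ballProb (Q : PMF Y) (x : X) :
    (ballProb d D Q x).toReal = ∑ y, if d x y ≤ D then (Q y).toReal else 0 := by
  rw [ballProb, PMF.toOuterMeasure_apply_fintype, ENNReal.toReal_sum]
  · refine Finset.sum_congr rfl fun y _ => ?_
    by_cases h : d x y ≤ D <;> simp [Set.indicator, ball, h]
  · intro y _
    exact ((Set.indicator_le_self _ _ _).trans_lt (Q.apply_lt_top y)).ne

variable {d D} in
theorem IsBallRestriction.ballProb_ne_zero {S : Set X} {Q : PMF Y} {W : X → PMF Y}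
    (h : IsBallRestriction d D S Q W) {x : X} (hx : x ∈ S) : ballProb d D Q x ≠ 0 := by
  intro h0
  have hz : ∀ y, W x y = 0 := by
    intro y
    rw [h x hx y]
    by_cases hy : y ∈ ball d D x
    · have : Q y = 0 := by
        rw [ballProb, PMF.toOuterMeasure_apply_fintype] at h0
        have := Finset.sum_eq_zero_iff.1 h0 y (Finset.mem_univ y)
        rwa [Set.indicator_of_mem hy] at this
      rw [this, mul_zero]
    · simp [hy]
  have := sum_pmf_coe (W x)
  simp [hz] at this

variable {d D} in
theorem IsBallRestriction.mul_ballProb {S : Set X} {Q : PMF Y} {W : X → PMF Y}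
    (h : IsBallRestriction d D S Q W) {x : X} (hx : x ∈ S) {y : Y} (hy : y ∈ ball d D x) :
    W x y * ballProb d D Q x = Q y := by
  rw [h x hx y, Set.indicator_of_mem hy, mul_right_comm, one_div,
    ENNReal.inv_mul_cancel (h.ballProb_ne_zero hx) (ballProb_ne_top d D Q x), one_mul]

theorem exists_isBallRestriction {S : Set X} {Q : PMF Y} (h : ∀ x ∈ S, ballProb d D Q x ≠ 0) :
    ∃ W : X → PMF Y, IsBallRestriction d D S Q W := by
  classical
  -- Rows outside `S` are unconstrained; `Q` is a filler.
  refine ⟨fun x => if hx : x ∈ S then PMF.ofFintype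
    (fun y => (ball d D x).indicator (fun _ => 1 / ballProb d D Q x) y * Q y) ?_ else Q, ?_⟩
  · have : ∀ y, (ball d D x).indicator (fun _ => 1 / ballProb d D Q x) y * Q y
        = (ballProb d D Q x)⁻¹ * (ball d D x).indicator Q y := by
      intro y
      by_cases hy : y ∈ ball d D x <;> simp [hy]
    simp only [this]
    rw [← Finset.mul_sum, ← PMF.toOuterMeasure_apply_fintype]
    exact ENNReal.inv_mul_cancel (h x hx) (ballProb_ne_top d D Q x)
  · intro x hx y
    simp only [hx, dif_pos, PMF.ofFintype_apply]

variable [Fintype X]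

theorem toReal_pos_of_mem_support {Z : Type*} {P : PMF Z} {x : Z} (hx : x ∈ P.support) :
    0 < (P x).toReal :=
  ENNReal.toReal_pos hx (P.apply_ne_top x)

theorem expLogInvBall_eq_coe {P : PMF X} {Q : PMF Y}
    (h : ∀ x ∈ P.support, ballProb d D Q x ≠ 0) :
    expLogInvBall d D P Q =
      ((∑ x, (P x).toReal * -Real.log (ballProb d D Q x).toReal : ℝ) : EReal) := by
  rw [expLogInvBall, ereal_coe_sum]
  refine Finset.sum_congr rfl fun x _ => ?_
  by_cases hx : x ∈ P.support
  · rw [EReal.coe_mul, ereal_coe_eq, one_div, ENNReal.log_inv,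
      ENNReal.log_pos_real (h x hx) (ballProb_ne_top d D Q x), EReal.coe_neg]
  · rw [PMF.mem_support_iff, not_not] at hx
    simp [hx]

end Ball

/-! ### Two bounds on mutual information -/

section MutualInfo

section

variable {X Y U : Type*} [Fintype X] [Fintype U]
  (P : PMF X) (W : X → PMF Y) (V : X → PMF U)

theorem outReal_nonneg (y : Y) : 0 ≤ outReal P W V y :=
  Finset.sum_nonneg fun u _ => jointReal_nonneg P W V u y

theorem outReal_eq (y : Y) : outReal P W V y = ∑ x, (P x).toReal * (W x y).toReal := by
  simp only [outReal, jointReal]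
  rw [Finset.sum_comm]
  refine Finset.sum_congr rfl fun x _ => ?_
  rw [← Finset.sum_mul, ← Finset.mul_sum, sum_toReal_pmf, mul_one]

end

variable {X Y U : Type*} [Fintype X] [Fintype Y] [Fintype U]
  (P : PMF X) (W : X → PMF Y) (V : X → PMF U)

theorem mutualInfo_eq_sum : mutualInfo P W V = ∑ y, ∑ u, jointReal P W V u y *
    (Real.log (jointReal P W V u y) - Real.log (outReal P W V y)
      - Real.log (margReal P V u)) := by
  have h : ∑ u, margReal P V u * Real.log (margReal P V u)
      = ∑ y, ∑ u, jointReal P W V u y * Real.log (margReal P V u) := by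
    rw [Finset.sum_comm]
    refine Finset.sum_congr rfl fun u _ => ?_
    rw [← Finset.sum_mul, sum_jointReal]
  rw [mutualInfo, h, ← Finset.sum_sub_distrib, ← Finset.sum_sub_distrib]
  refine Finset.sum_congr rfl fun y _ => ?_
  nth_rewrite 1 [outReal]
  rw [Finset.sum_mul, ← Finset.sum_sub_distrib, ← Finset.sum_sub_distrib]
  refine Finset.sum_congr rfl fun u _ => ?_
  ring

/-- Combines data processing, `I(U; Y) ≤ I(X; Y)`, with `I(X; Y) ≤ 𝔼[D(W x ‖ Q)]`, where `D(W x ‖ Q)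
= -log (β x)` because the density is `1 / β x`. Both come out of a single use of `log z ≤ z - 1`,
averaged over `(x, u, y)`. -/
theorem mutualInfo_le_of_mul_eq (Q : PMF Y) (β : X → ℝ)
    (h : ∀ x y, 0 < (P x).toReal → 0 < (W x y).toReal →
      0 < β x ∧ (W x y).toReal * β x = (Q y).toReal) :
    mutualInfo P W V ≤ ∑ x, (P x).toReal * -Real.log (β x) := by
  let t : Y → U → X → ℝ := fun y u x => (P x).toReal * (V x u).toReal * (W x y).toReal
  have hj : ∀ y u, jointReal P W V u y = ∑ x, t y u x := fun y u => rfl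
  have ht0 : ∀ y u x, 0 ≤ t y u x := fun y u x => by positivity
  have hR : ∑ x, (P x).toReal * -Real.log (β x) = ∑ y, ∑ u, ∑ x, t y u x * -Real.log (β x) := by
    have h1 : ∀ x, (P x).toReal = ∑ y, ∑ u, t y u x := by
      intro x
      simp only [t, ← Finset.mul_sum, ← Finset.sum_mul, sum_toReal_pmf, mul_one]
    simp only [h1, Finset.sum_mul]
    rw [Finset.sum_comm]
    exact Finset.sum_congr rfl fun y _ => Finset.sum_comm
  rw [mutualInfo_eq_sum, hR, ← sub_nonpos, ← Finset.sum_sub_distrib]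
  have key : ∀ y u x, t y u x * (Real.log (jointReal P W V u y) - Real.log (outReal P W V y)
      - Real.log (margReal P V u)) - t y u x * -Real.log (β x) ≤
      (P x).toReal * (V x u).toReal * (jointReal P W V u y * (Q y).toReal /
        (outReal P W V y * margReal P V u)) - t y u x := by
    intro y u x
    have hjn := jointReal_nonneg P W V u y
    have hqn := outReal_nonneg P W V y
    have hmn := margReal_nonneg P V u
    rcases (ht0 y u x).eq_or_lt with h0 | hpos
    · rw [← h0]
      simp only [zero_mul, sub_zero]
      positivity
    · have hP : 0 < (P x).toReal := ENNReal.toReal_nonneg.lt_of_ne' fun h0 => by simp [t, h0] at hpos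
      have hW : 0 < (W x y).toReal :=
        ENNReal.toReal_nonneg.lt_of_ne' fun h0 => by simp [t, h0] at hpos
      obtain ⟨hβ, hQ⟩ := h x y hP hW
      have hjpos : 0 < jointReal P W V u y :=
        hpos.trans_le (Finset.single_le_sum (fun x _ => ht0 y u x) (Finset.mem_univ x))
      have hqpos : 0 < outReal P W V y := hjpos.trans_le (Finset.single_le_sum
        (f := fun u => jointReal P W V u y) (fun u _ => jointReal_nonneg P W V u y)
        (Finset.mem_univ u))
      have hmpos : 0 < margReal P V u := by
        rw [← sum_jointReal P W V u]
        exact hjpos.trans_le (Finset.single_le_sum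
          (fun y _ => jointReal_nonneg P W V u y) (Finset.mem_univ y))
      have hlog := Real.log_le_sub_one_of_pos (x := jointReal P W V u y * β x /
        (outReal P W V y * margReal P V u)) (by positivity)
      rw [Real.log_div (by positivity) (by positivity), Real.log_mul hjpos.ne' hβ.ne',
        Real.log_mul hqpos.ne' hmpos.ne'] at hlog
      have h2 := mul_le_mul_of_nonneg_left hlog hpos.le
      -- The relation `W β = Q` eliminates `β x`; afterwards `x` occurs only in `P x * V x u`, whose
      -- sum is the law of `U`.
      have h3 : t y u x * (jointReal P W V u y * β x / (outReal P W V y * margReal P V u)) =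
          (P x).toReal * (V x u).toReal * (jointReal P W V u y * (Q y).toReal /
        (outReal P W V y * margReal P V u)) := by
        rw [← hQ]; simp only [t]; ring
      rw [mul_sub _ (_ / _), h3] at h2
      linarith
  calc _ = ∑ y, ∑ u, ∑ x, (t y u x * (Real.log (jointReal P W V u y) -
        Real.log (outReal P W V y) - Real.log (margReal P V u)) - t y u x * -Real.log (β x)) := by
        refine Finset.sum_congr rfl fun y _ => ?_
        rw [← Finset.sum_sub_distrib]
        refine Finset.sum_congr rfl fun u _ => ?_
        rw [Finset.sum_sub_distrib, ← Finset.sum_mul, ← hj]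
    _ ≤ ∑ y, ∑ u, ∑ x, ((P x).toReal * (V x u).toReal * (jointReal P W V u y * (Q y).toReal /
        (outReal P W V y * margReal P V u)) - t y u x) :=
        Finset.sum_le_sum fun y _ => Finset.sum_le_sum fun u _ => Finset.sum_le_sum fun x _ =>
          key y u x
    _ = ∑ y, ∑ u, (margReal P V u * (jointReal P W V u y * (Q y).toReal /
        (outReal P W V y * margReal P V u)) - jointReal P W V u y) := by
        refine Finset.sum_congr rfl fun y _ => Finset.sum_congr rfl fun u _ => ?_
        rw [Finset.sum_sub_distrib, ← Finset.sum_mul, ← hj]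
        rfl
    -- Only an inequality, since the cancelled factor may vanish; the next inequality has the same
    -- cause.
    _ ≤ ∑ y, ∑ u, (jointReal P W V u y * ((Q y).toReal / outReal P W V y)
        - jointReal P W V u y) := by
        refine Finset.sum_le_sum fun y _ => Finset.sum_le_sum fun u _ => sub_le_sub_right ?_ _
        have hjn := jointReal_nonneg P W V u y
        have hqn := outReal_nonneg P W V y
        rcases (margReal_nonneg P V u).eq_or_lt with h0 | hpos
        · rw [← h0, zero_mul]; positivity
        · refine le_of_eq ?_
          rw [mul_comm (outReal P W V y), ← div_div, ← mul_div_assoc, ← mul_div_assoc]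
          field_simp
    _ = ∑ y, outReal P W V y * ((Q y).toReal / outReal P W V y) - ∑ y, outReal P W V y := by
        rw [← Finset.sum_sub_distrib]
        refine Finset.sum_congr rfl fun y _ => ?_
        rw [Finset.sum_sub_distrib, ← Finset.sum_mul]; rfl
    _ ≤ ∑ y, (Q y).toReal - ∑ y, outReal P W V y := by
        refine sub_le_sub_right (Finset.sum_le_sum fun y _ => ?_) _
        rcases (outReal_nonneg P W V y).eq_or_lt with h0 | hpos
        · rw [← h0, zero_mul]; positivity
        · exact (mul_div_cancel₀ _ hpos.ne').le
    _ = 0 := by rw [sum_toReal_pmf, sum_outReal, sub_self]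

open Classical in
-- For `U = X` the mutual information is `𝔼[D(W x ‖ q)]`, with `q` the law of `Y`. Since `W x` lives
-- on the set `B x`, nonnegativity of its divergence from `q` conditioned on `B x` gives `D(W x ‖ q)
-- ≥ -log q(B x)`.
theorem le_mutualInfo_pure (β : X → ℝ) (B : X → Y → Prop)
    (hB : ∀ x y, 0 < (P x).toReal → 0 < (W x y).toReal → B x y)
    (hβ : ∀ x, β x = ∑ y, if B x y then outReal P W PMF.pure y else 0) :
    ∑ x, (P x).toReal * -Real.log (β x) ≤ mutualInfo P W (PMF.pure : X → PMF X) := by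
  have hpure : ∀ x x' : X, ((PMF.pure x') x).toReal = if x' = x then 1 else 0 := by
    intro x x'
    simp only [PMF.pure_apply, eq_comm (a := x)]
    split_ifs <;> simp
  have hj : ∀ x y, jointReal P W (PMF.pure : X → PMF X) x y = (P x).toReal * (W x y).toReal := by
    intro x y
    simp only [jointReal, hpure]
    simp
  have hm : ∀ x, margReal P (PMF.pure : X → PMF X) x = (P x).toReal := by
    intro x
    simp only [margReal, hpure]
    simp
  set q := outReal P W (PMF.pure : X → PMF X) with hq
  have hqn : ∀ y, 0 ≤ q y := outReal_nonneg P W _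
  have hβn : ∀ x, 0 ≤ β x := by
    intro x
    rw [hβ]
    exact Finset.sum_nonneg fun y _ => by split_ifs <;> simp [hqn]
  have hL : ∑ x, (P x).toReal * -Real.log (β x)
      = ∑ y, ∑ x, (P x).toReal * (W x y).toReal * -Real.log (β x) := by
    rw [Finset.sum_comm]
    refine Finset.sum_congr rfl fun x _ => ?_
    rw [← Finset.sum_mul, ← Finset.mul_sum, sum_toReal_pmf, mul_one]
  rw [mutualInfo_eq_sum, hL, ← sub_nonpos, ← Finset.sum_sub_distrib]
  simp only [hj, hm, ← hq, ← Finset.sum_sub_distrib]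
  have key : ∀ y x, (P x).toReal * (W x y).toReal * -Real.log (β x) -
      (P x).toReal * (W x y).toReal * (Real.log ((P x).toReal * (W x y).toReal) -
        Real.log (q y) - Real.log (P x).toReal) ≤
      (P x).toReal * ((if B x y then q y else 0) / β x) - (P x).toReal * (W x y).toReal := by
    intro y x
    have hrhs : 0 ≤ (P x).toReal * ((if B x y then q y else 0) / β x) := by
      have := hβn x
      have : 0 ≤ if B x y then q y else 0 := by split_ifs <;> simp [hqn]
      positivity
    rcases (ENNReal.toReal_nonneg : 0 ≤ (P x).toReal).eq_or_lt with h0 | hP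
    · simp [← h0]
    rcases (ENNReal.toReal_nonneg : 0 ≤ (W x y).toReal).eq_or_lt with h0 | hW
    · rw [← h0]
      simpa using hrhs
    have hBxy := hB x y hP hW
    have hqpos : 0 < q y := by
      refine (mul_pos hP hW).trans_le ?_
      rw [← hj]
      exact Finset.single_le_sum (f := fun u => jointReal P W (PMF.pure : X → PMF X) u y)
        (fun u _ => jointReal_nonneg P W _ u y) (Finset.mem_univ x)
    have hβpos : 0 < β x := by
      rw [hβ]
      refine Finset.sum_pos' (fun y _ => by split_ifs <;> simp [hqn])
        ⟨y, Finset.mem_univ y, by simpa [hBxy] using hqpos⟩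
    have hlog := Real.log_le_sub_one_of_pos (x := q y / ((W x y).toReal * β x)) (by positivity)
    rw [Real.log_div (by positivity) (by positivity), Real.log_mul hW.ne' hβpos.ne'] at hlog
    have h2 := mul_le_mul_of_nonneg_left hlog (mul_pos hP hW).le
    have h3 : (P x).toReal * (W x y).toReal * (q y / ((W x y).toReal * β x))
        = (P x).toReal * (q y / β x) := by
      field_simp
    rw [mul_sub _ (_ / _), h3] at h2
    rw [if_pos hBxy, Real.log_mul hP.ne' hW.ne']
    linarith
  calc _ ≤ ∑ y, ∑ x, ((P x).toReal * ((if B x y then q y else 0) / β x)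
        - (P x).toReal * (W x y).toReal) :=
        Finset.sum_le_sum fun y _ => Finset.sum_le_sum fun x _ => key y x
    _ = ∑ x, ((P x).toReal * (β x / β x) - (P x).toReal) := by
        rw [Finset.sum_comm]
        refine Finset.sum_congr rfl fun x _ => ?_
        rw [Finset.sum_sub_distrib, ← Finset.mul_sum, ← Finset.mul_sum, sum_toReal_pmf, mul_one,
          ← Finset.sum_div, ← hβ]
    _ ≤ 0 := by
        refine Finset.sum_nonpos fun x _ => ?_
        have : (P x).toReal * (β x / β x) ≤ (P x).toReal * 1 :=
          mul_le_mul_of_nonneg_left (div_self_le_one _) ENNReal.toReal_nonneg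
        linarith

end MutualInfo

/-! ### The tradeoff at order one -/

section OrderOne

variable {X Y : Type*} [Fintype X] [Fintype Y] {d : X → Y → ℝ} {D : ℝ} {P : PMF X}
  {W : X → PMF Y}

theorem IsBallRestriction.maxAlphaLeakage_one_le {Q : PMF Y}
    (h : IsBallRestriction d D P.support Q W) :
    maxAlphaLeakage 1 P W ≤ expLogInvBall d D P Q := by
  refine maxAlphaLeakage_le P W le_rfl fun n V L hL => ?_
  have := orderFilter_neBot (le_refl (1 : ℝ≥0∞))
  rw [tendsto_nhds_unique hL (tendsto_logGainRatio_one P W V),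
    expLogInvBall_eq_coe d D fun x hx => h.ballProb_ne_zero hx, EReal.coe_le_coe_iff]
  refine mutualInfo_le_of_mul_eq P W V Q _ fun x y hP hW => ?_
  have hx : x ∈ P.support := fun h0 => by simp [h0] at hP
  have hy : W x y ≠ 0 := fun h0 => by simp [h0] at hW
  refine ⟨ENNReal.toReal_pos (h.ballProb_ne_zero hx) (ballProb_ne_top d D Q x), ?_⟩
  rw [← ENNReal.toReal_mul, h.mul_ballProb hx (h.mem_ball hx hy)]

/-- The witnesses are `U = X` and, for `Q`, the output law `P.bind W`. Feasibility gives each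
relevant ball positive output mass. -/
theorem HardDistortion.iInf_expLogInvBall_le (h : HardDistortion d D P W) :
    ⨅ Q : PMF Y, expLogInvBall d D P Q ≤ maxAlphaLeakage 1 P W := by
  classical
  refine le_trans ?_ (le_maxAlphaLeakage P W (PMF.pure : X → PMF X) le_rfl
    (tendsto_logGainRatio_one P W _))
  refine (iInf_le _ (P.bind W)).trans ?_
  have hQ : ∀ y, ((P.bind W) y).toReal = outReal P W (PMF.pure : X → PMF X) y := by
    intro y
    rw [outReal_eq, PMF.bind_apply, tsum_fintype, ENNReal.toReal_sum fun x _ =>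
      ENNReal.mul_ne_top (P.apply_ne_top x) ((W x).apply_ne_top y)]
    simp
  have hne : ∀ x ∈ P.support, ballProb d D (P.bind W) x ≠ 0 := by
    intro x hx h0
    rw [ballProb, PMF.toOuterMeasure_apply_eq_zero_iff] at h0
    obtain ⟨y, hy⟩ := (W x).support_nonempty
    exact Set.disjoint_left.1 h0 ((PMF.mem_support_bind_iff _ _ _).2 ⟨x, hx, hy⟩) (h x hx y hy)
  rw [expLogInvBall_eq_coe d D hne, EReal.coe_le_coe_iff]
  refine le_mutualInfo_pure P W _ (fun x y => d x y ≤ D) (fun x y hP hW => ?_) fun x => ?_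
  · exact h x (fun h0 => by simp [h0] at hP) y (fun h0 => by simp [h0] at hW)
  · rw [toReal_ballProb]
    simp only [hQ]

end OrderOne

/-! ### Orders above one: the upper bound -/

section OrderAboveOneUpper

variable {X Y U : Type*} [Fintype X] [Fintype Y] [Fintype U]

/-- Jensen for a concave power, obtained from Hölder by splitting `w` as `w ^ (1 / a) * w ^ ((a - 1)
/ a)`. -/
theorem pmf_sum_mul_rpow_le {Z : Type*} [Fintype Z] {a : ℝ} (ha : 1 < a) (w : PMF Z)
    (g : Z → ℝ≥0∞) :
    ∑ z, w z * g z ^ ((a - 1) / a) ≤ (∑ z, w z * g z) ^ ((a - 1) / a) := by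
  have ha0 : 0 < a := by linarith
  have hθ : 0 ≤ (a - 1) / a := div_nonneg (by linarith) ha0.le
  have h := ennreal_sum_mul_rpow_le ha (fun z => w z ^ (1 / a)) (fun z => w z * g z)
  have h1 : ∀ z, (w z ^ (1 / a)) ^ a = w z := fun z => by
    rw [← ENNReal.rpow_mul, one_div_mul_cancel ha0.ne', ENNReal.rpow_one]
  have h2 : ∀ z, w z ^ (1 / a) * (w z * g z) ^ ((a - 1) / a) = w z * g z ^ ((a - 1) / a) := by
    intro z
    rw [ENNReal.mul_rpow_of_nonneg _ _ hθ, ← mul_assoc,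
      ← ENNReal.rpow_add_of_nonneg _ _ (by positivity) hθ]
    have : 1 / a + (a - 1) / a = 1 := by field_simp; ring
    rw [this, ENNReal.rpow_one]
  simpa only [h1, h2, sum_pmf_coe, ENNReal.one_rpow, one_mul] using h

variable {d : X → Y → ℝ} {D : ℝ} {P : PMF X} {W : X → PMF Y} {Q : PMF Y}

theorem IsBallRestriction.le_inv_mul {X Y : Type*} {d : X → Y → ℝ} {P : PMF X}
    {W : X → PMF Y} {Q : PMF Y} (h : IsBallRestriction d D P.support Q W) {x : X}
    (hx : x ∈ P.support) (y : Y) :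
    W x y ≤ (minBallProb d D P.support Q)⁻¹ * Q y := by
  rw [h x hx y]
  gcongr
  by_cases hy : y ∈ ball d D x
  · rw [Set.indicator_of_mem hy, one_div]
    exact ENNReal.inv_le_inv.2 (iInf₂_le x hx)
  · rw [Set.indicator_of_notMem hy]
    exact zero_le

/-- A strategy `G` is simulated blindly by `Q.bind G`: draw `y` from `Q`, then guess by `G y`.
Jensen moves the power outside the average over `y`, and the density bound replaces `W x` by `Q`. -/
theorem IsBallRestriction.gainObserving_le (h : IsBallRestriction d D P.support Q W)
    (V : X → PMF U) {a : ℝ} (ha : 1 < a) :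
    gainObserving a P W V ≤
      (minBallProb d D P.support Q)⁻¹ ^ ((a - 1) / a) * gainBlind a P V := by
  have ha0 : 0 < a := by linarith
  have hθ : 0 ≤ (a - 1) / a := div_nonneg (by linarith) ha0.le
  set r := (minBallProb d D P.support Q)⁻¹
  refine iSup_le fun G => ?_
  refine le_trans ?_ (mul_le_mul_right (le_iSup (fun G : PMF U =>
    ∑ u, margU P V u * (G u) ^ ((a - 1) / a)) (Q.bind G)) (r ^ ((a - 1) / a)))
  rw [Finset.mul_sum]
  refine Finset.sum_le_sum fun u _ => ?_
  have hb : (Q.bind G) u = ∑ y, Q y * G y u := by rw [PMF.bind_apply, tsum_fintype]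
  calc ∑ y, jointUY P W V u y * G y u ^ ((a - 1) / a)
      = ∑ x, P x * V x u * ∑ y, W x y * G y u ^ ((a - 1) / a) := by
        simp only [jointUY, Finset.sum_mul, Finset.mul_sum, mul_assoc]
        exact Finset.sum_comm
    _ ≤ ∑ x, P x * V x u * (r * (Q.bind G) u) ^ ((a - 1) / a) := by
        refine Finset.sum_le_sum fun x _ => ?_
        by_cases hx : x ∈ P.support
        · refine mul_le_mul_right ((pmf_sum_mul_rpow_le ha (W x) _).trans ?_) _
          refine ENNReal.rpow_le_rpow ?_ hθ
          rw [hb, Finset.mul_sum]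
          refine Finset.sum_le_sum fun y _ => ?_
          rw [← mul_assoc]
          exact mul_le_mul_left (h.le_inv_mul hx y) _
        · rw [PMF.mem_support_iff, not_not] at hx
          simp [hx]
    _ = r ^ ((a - 1) / a) * (margU P V u * (Q.bind G) u ^ ((a - 1) / a)) := by
        rw [← Finset.sum_mul, ENNReal.mul_rpow_of_nonneg _ _ hθ, margU]
        ring

theorem IsBallRestriction.logGainRatio_le (h : IsBallRestriction d D P.support Q W)
    (V : X → PMF U) {a : ℝ} (ha : 1 < a) :
    logGainRatio a P W V ≤ -ENNReal.log (minBallProb d D P.support Q) := by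
  have ha0 : 0 < a := by linarith
  have ha1 : a - 1 ≠ 0 := by linarith
  have h1 : gainObserving a P W V / gainBlind a P V
      ≤ (minBallProb d D P.support Q)⁻¹ ^ ((a - 1) / a) :=
    ENNReal.div_le_of_le_mul (h.gainObserving_le V ha)
  have h2 : ((a / (a - 1) : ℝ) : EReal) * ENNReal.log
      ((minBallProb d D P.support Q)⁻¹ ^ ((a - 1) / a))
      = -ENNReal.log (minBallProb d D P.support Q) := by
    rw [ENNReal.log_rpow, ENNReal.log_inv, ← mul_assoc, ← EReal.coe_mul]
    have : a / (a - 1) * ((a - 1) / a) = 1 := by field_simp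
    rw [this, EReal.coe_one, one_mul]
  rw [← h2, logGainRatio]
  refine mul_le_mul_of_nonneg_left (ENNReal.log_le_log h1) ?_
  exact EReal.coe_nonneg.2 (div_nonneg ha0.le (by linarith))

theorem IsBallRestriction.maxAlphaLeakage_le (h : IsBallRestriction d D P.support Q W)
    {α : ℝ≥0∞} (hα : 1 ≤ α) :
    maxAlphaLeakage α P W ≤ -ENNReal.log (minBallProb d D P.support Q) := by
  have := orderFilter_neBot hα
  refine AlphaLeak.maxAlphaLeakage_le P W hα fun n V L hL => le_of_tendsto hL ?_
  filter_upwards [eventually_one_lt_toReal α] with b hb using h.logGainRatio_le V hb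

end OrderAboveOneUpper

/-! ### Orders above one: estimates for split inputs -/

section RealEstimates

variable {ι Y : Type*} [Fintype ι] [Fintype Y]

theorem real_sum_mul_rpow_le {a : ℝ} (ha : 1 < a) {c g : ι → ℝ} (hc : ∀ i, 0 ≤ c i)
    (hg : ∀ i, 0 ≤ g i) :
    ∑ i, c i * g i ^ ((a - 1) / a) ≤ powNorm a c * (∑ i, g i) ^ ((a - 1) / a) := by
  have h := Real.inner_le_Lp_mul_Lq_of_nonneg Finset.univ (f := c)
    (g := fun i => g i ^ ((a - 1) / a)) (Real.HolderConjugate.conjExponent ha)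
    (fun i _ => hc i) (fun i _ => Real.rpow_nonneg (hg i) _)
  have hq : (a - 1) / a * Real.conjExponent a = 1 := by
    have : a - 1 ≠ 0 := by linarith
    have : a ≠ 0 := by linarith
    rw [Real.conjExponent]; field_simp
  have hq' : 1 / Real.conjExponent a = (a - 1) / a := by
    rw [Real.conjExponent, one_div_div]
  simpa only [← Real.rpow_mul (hg _), hq, hq', Real.rpow_one, powNorm] using h

/-- The left side is the form to which Hölder applies, the right side the contribution of `m` equal
atoms of mass `p / m`. -/
theorem mul_rpow_neg_rpow {a p m : ℝ} (ha : 1 < a) (hp : 0 ≤ p) (hm : 0 < m) :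
    (p * m ^ (-((a - 1) / a))) ^ a = m * (p / m) ^ a := by
  have ha0 : a ≠ 0 := by linarith
  rw [Real.mul_rpow hp (Real.rpow_nonneg hm.le _), ← Real.rpow_mul hm.le, Real.div_rpow hp hm.le,
    neg_mul, div_mul_cancel₀ _ ha0, neg_sub, Real.rpow_sub hm, Real.rpow_one]
  ring

/-- Hölder for each `y` against the test weights `π` restricted to the inputs compatible with `y`,
of mass at most `s`. Summing over `y` removes `w`, because the restriction is invisible where `w` is
nonzero. -/
theorem sum_mul_div_rpow_le_of_split {a s : ℝ} (ha : 1 < a) {p π m : ι → ℝ} {w : ι → Y → ℝ}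
    {B : ι → Y → Prop} [∀ x y, Decidable (B x y)] (hp : ∀ x, 0 ≤ p x) (hπ : ∀ x, 0 ≤ π x)
    (hm : ∀ x, 0 < m x) (hw : ∀ x y, 0 ≤ w x y) (hw1 : ∀ x, ∑ y, w x y = 1)
    (hB : ∀ x y, w x y ≠ 0 → B x y) (hs : ∀ y, (∑ x, if B x y then π x else 0) ≤ s) :
    ∑ x, p x * (π x / m x) ^ ((a - 1) / a) ≤
      (∑ y, (∑ x, m x * (p x / m x * w x y) ^ a) ^ (1 / a)) * s ^ ((a - 1) / a) := by
  have hθ : 0 ≤ (a - 1) / a := div_nonneg (by linarith) (by linarith)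
  have hg : ∀ y x, 0 ≤ if B x y then π x else 0 := fun y x => by split_ifs <;> simp [hπ]
  have hy : ∀ y, ∑ x, w x y * (p x * (π x / m x) ^ ((a - 1) / a)) ≤
      (∑ x, m x * (p x / m x * w x y) ^ a) ^ (1 / a) * s ^ ((a - 1) / a) := by
    intro y
    have h := real_sum_mul_rpow_le ha (c := fun x => p x * w x y * m x ^ (-((a - 1) / a)))
      (fun x => mul_nonneg (mul_nonneg (hp x) (hw x y)) (Real.rpow_nonneg (hm x).le _)) (hg y)
    have h1 : ∀ x, p x * w x y * m x ^ (-((a - 1) / a)) *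
        (if B x y then π x else 0) ^ ((a - 1) / a) =
        w x y * (p x * (π x / m x) ^ ((a - 1) / a)) := by
      intro x
      by_cases h0 : w x y = 0
      · simp [h0]
      · rw [if_pos (hB x y h0), Real.div_rpow (hπ x) (hm x).le, Real.rpow_neg (hm x).le]
        ring
    have h2 : powNorm a (fun x => p x * w x y * m x ^ (-((a - 1) / a))) =
        (∑ x, m x * (p x / m x * w x y) ^ a) ^ (1 / a) := by
      rw [powNorm]
      congr 1
      refine Finset.sum_congr rfl fun x _ => ?_
      rw [mul_rpow_neg_rpow ha (mul_nonneg (hp x) (hw x y)) (hm x), div_mul_eq_mul_div]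
    simp only [h1, h2] at h
    refine h.trans (mul_le_mul_of_nonneg_left (Real.rpow_le_rpow
      (Finset.sum_nonneg fun x _ => hg y x) (hs y) hθ) (Real.rpow_nonneg ?_ _))
    exact Finset.sum_nonneg fun x _ => mul_nonneg (hm x).le (Real.rpow_nonneg
      (mul_nonneg (div_nonneg (hp x) (hm x).le) (hw x y)) _)
  calc _ = ∑ y, ∑ x, w x y * (p x * (π x / m x) ^ ((a - 1) / a)) := by
        rw [Finset.sum_comm]
        simp only [← Finset.sum_mul, hw1, one_mul]
    _ ≤ _ := by
        rw [Finset.sum_mul]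
        exact Finset.sum_le_sum fun y _ => hy y

/-- If `m = N c` and `p c ^ (-θ) π ^ (θ - 1) = 1` held exactly, then `p m ^ (-θ)` would be `N ^ (-θ)
π ^ (1 / a)`. The blind gain would be `N ^ (-θ)`, the observing gain at least `N ^ (-θ) s ^ (-θ)`,
and the bound `-log s`. Rounding `m` costs `(1 + δ) ^ θ` and the inexact identity costs `1 + δ` in
each gain; after division by `θ` this is the factor `1 + 2 / θ`. -/
theorem log_ratio_ge_of_split {a s N δ : ℝ} (ha : 1 < a) (hs0 : 0 < s) (hN : 0 < N) (hδ : 0 < δ)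
    {p π m c : ι → ℝ} {w : ι → Y → ℝ} {B : ι → Y → Prop} [∀ x y, Decidable (B x y)]
    (hp : ∀ x, 0 < p x) (hπ : ∀ x, 0 < π x) (hπ1 : ∑ x, π x = 1)
    (hc : ∀ x, 0 < c x) (hw : ∀ x y, 0 ≤ w x y) (hw1 : ∀ x, ∑ y, w x y = 1)
    (hB : ∀ x y, w x y ≠ 0 → B x y) (hs : ∀ y, (∑ x, if B x y then π x else 0) ≤ s)
    (hm1 : ∀ x, N * c x ≤ m x) (hm2 : ∀ x, m x ≤ N * c x * (1 + δ))
    (he1 : ∀ x, (1 + δ)⁻¹ ≤ p x * c x ^ (-((a - 1) / a)) * π x ^ ((a - 1) / a - 1))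
    (he2 : ∀ x, p x * c x ^ (-((a - 1) / a)) * π x ^ ((a - 1) / a - 1) ≤ 1 + δ) :
    -Real.log s - (1 + 2 / ((a - 1) / a)) * Real.log (1 + δ) ≤
      a / (a - 1) * (Real.log (∑ y, (∑ x, m x * (p x / m x * w x y) ^ a) ^ (1 / a))
        - Real.log ((∑ x, m x * (p x / m x) ^ a) ^ (1 / a))) := by
  have ha0 : 0 < a := by linarith
  have hm : ∀ x, 0 < m x := fun x => (mul_pos hN (hc x)).trans_le (hm1 x)
  have hinv : a / (a - 1) = 1 / ((a - 1) / a) := by rw [one_div_div]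
  have hA := sum_mul_div_rpow_le_of_split ha (fun x => (hp x).le) (fun x => (hπ x).le) hm hw hw1 hB hs
  rw [hinv]
  have hblind0 : ∀ x, m x * (p x / m x) ^ a = (p x * m x ^ (-((a - 1) / a))) ^ a := fun x =>
    (mul_rpow_neg_rpow ha (hp x).le (hm x)).symm
  set θ := (a - 1) / a with hθdef
  have hθ : 0 < θ := div_pos (by linarith) ha0
  have hδ1 : 0 < 1 + δ := by linarith
  have hnum : (N * (1 + δ)) ^ (-θ) * (1 + δ)⁻¹ ≤ ∑ x, p x * (π x / m x) ^ θ := by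
    calc (N * (1 + δ)) ^ (-θ) * (1 + δ)⁻¹ = ∑ x, (N * (1 + δ)) ^ (-θ) * (1 + δ)⁻¹ * π x := by
          rw [← Finset.mul_sum, hπ1, mul_one]
      _ ≤ ∑ x, p x * (π x / m x) ^ θ := by
          refine Finset.sum_le_sum fun x _ => ?_
          calc (N * (1 + δ)) ^ (-θ) * (1 + δ)⁻¹ * π x
              ≤ (N * (1 + δ)) ^ (-θ) * (p x * c x ^ (-θ) * π x ^ (θ - 1)) * π x := by
                gcongr
                · exact (hπ x).le
                · exact he1 x
            _ = p x * (π x / (N * c x * (1 + δ))) ^ θ := by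
                have hmc : N * c x * (1 + δ) = N * (1 + δ) * c x := by ring
                rw [hmc, Real.div_rpow (hπ x).le (by have := hc x; positivity),
                  Real.mul_rpow (by positivity) (hc x).le, Real.rpow_sub_one (hπ x).ne',
                  Real.rpow_neg (hc x).le, Real.rpow_neg (by positivity)]
                have := (hπ x).ne'
                field_simp
            _ ≤ p x * (π x / m x) ^ θ := by
                have h1 := hp x
                have h2 := hπ x
                have h3 := hm x
                have h4 := hm2 x
                have h5 : 0 ≤ π x / (N * c x * (1 + δ)) :=
                  div_nonneg h2.le (h3.le.trans h4)
                gcongr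
  have hblind : (∑ x, m x * (p x / m x) ^ a) ^ (1 / a) ≤ N ^ (-θ) * (1 + δ) := by
    have h1 : ∑ x, m x * (p x / m x) ^ a ≤ (N ^ (-θ) * (1 + δ)) ^ a := by
      calc ∑ x, m x * (p x / m x) ^ a ≤ ∑ x, (N ^ (-θ) * (1 + δ)) ^ a * π x := by
            refine Finset.sum_le_sum fun x _ => ?_
            rw [hblind0]
            have hmN : m x ^ (-θ) ≤ N ^ (-θ) * c x ^ (-θ) := by
              rw [← Real.mul_rpow hN.le (hc x).le]
              exact Real.rpow_le_rpow_of_nonpos (mul_pos hN (hc x)) (hm1 x) (by linarith)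
            have hpc : p x * c x ^ (-θ) ≤ (1 + δ) * π x ^ (1 / a) := by
              have h2 := mul_le_mul_of_nonneg_right (he2 x)
                (Real.rpow_nonneg (hπ x).le (1 / a))
              rw [mul_assoc _ (π x ^ (θ - 1)), ← Real.rpow_add (hπ x)] at h2
              have h3 : θ - 1 + 1 / a = 0 := by rw [hθdef]; field_simp; ring
              rwa [h3, Real.rpow_zero, mul_one] at h2
            have h4 : p x * m x ^ (-θ) ≤ N ^ (-θ) * (1 + δ) * π x ^ (1 / a) := by
              calc p x * m x ^ (-θ) ≤ p x * (N ^ (-θ) * c x ^ (-θ)) :=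
                    mul_le_mul_of_nonneg_left hmN (hp x).le
                _ = N ^ (-θ) * (p x * c x ^ (-θ)) := by ring
                _ ≤ N ^ (-θ) * ((1 + δ) * π x ^ (1 / a)) :=
                    mul_le_mul_of_nonneg_left hpc (Real.rpow_nonneg hN.le _)
                _ = _ := by ring
            refine (Real.rpow_le_rpow (mul_nonneg (hp x).le (Real.rpow_nonneg (hm x).le _)) h4
              ha0.le).trans_eq ?_
            rw [Real.mul_rpow (by positivity) (Real.rpow_nonneg (hπ x).le _),
              ← Real.rpow_mul (hπ x).le, one_div_mul_cancel ha0.ne', Real.rpow_one]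
        _ = _ := by rw [← Finset.mul_sum, hπ1, mul_one]
    calc _ ≤ ((N ^ (-θ) * (1 + δ)) ^ a) ^ (1 / a) := by
          refine Real.rpow_le_rpow (Finset.sum_nonneg fun x _ => mul_nonneg (hm x).le
            (Real.rpow_nonneg (div_nonneg (hp x).le (hm x).le) _)) h1 (by positivity)
      _ = _ := by
          rw [← Real.rpow_mul (by positivity), mul_one_div_cancel ha0.ne', Real.rpow_one]
  have hne : (Finset.univ : Finset ι).Nonempty := by
    by_contra h
    rw [Finset.not_nonempty_iff_eq_empty] at h
    simp [h] at hπ1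
  have hbpos : 0 < (∑ x, m x * (p x / m x) ^ a) ^ (1 / a) :=
    Real.rpow_pos_of_pos (Finset.sum_pos (fun x _ => mul_pos (hm x)
      (Real.rpow_pos_of_pos (div_pos (hp x) (hm x)) _)) hne) _
  have hlogb := Real.log_le_log hbpos hblind
  have hlogo := Real.log_le_log (by positivity) (hnum.trans hA)
  have hopos : 0 < ∑ y, (∑ x, m x * (p x / m x * w x y) ^ a) ^ (1 / a) := by
    have : 0 < (∑ y, (∑ x, m x * (p x / m x * w x y) ^ a) ^ (1 / a)) * s ^ θ :=
      lt_of_lt_of_le (by positivity) (hnum.trans hA)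
    exact pos_of_mul_pos_left this (Real.rpow_nonneg hs0.le _)
  rw [Real.log_mul (by positivity) (by positivity), Real.log_rpow hN] at hlogb
  rw [Real.log_mul (by positivity) (by positivity), Real.log_mul hopos.ne' (by positivity),
    Real.log_rpow (by positivity), Real.log_rpow hs0, Real.log_mul hN.ne' hδ1.ne',
    Real.log_inv] at hlogo
  rw [one_div_mul_eq_div, le_div_iff₀ hθ]
  have h5 : (-Real.log s - (1 + 2 / θ) * Real.log (1 + δ)) * θ =
      -(θ * Real.log s) - θ * Real.log (1 + δ) - 2 * Real.log (1 + δ) := by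
    field_simp
    ring
  rw [h5]
  linarith

/-- Round `N c` up, with `N` so large that `N * c x * δ ≥ 1` for all `x`; the added `1` in `N` keeps
it positive even for an empty index type. -/
theorem exists_nat_approx {ι : Type*} [Fintype ι] {c : ι → ℝ} (hc : ∀ x, 0 < c x) {δ : ℝ} (hδ : 0 < δ) :
    ∃ (N : ℝ) (m : ι → ℕ), 0 < N ∧ (∀ x, N * c x ≤ m x) ∧ ∀ x, (m x : ℝ) ≤ N * c x * (1 + δ) := by
  have h0 : ∀ x, 0 ≤ 1 / (c x * δ) := fun x => by have := hc x; positivity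
  refine ⟨∑ x, 1 / (c x * δ) + 1, fun x => ⌈(∑ x, 1 / (c x * δ) + 1) * c x⌉₊, ?_,
    fun x => Nat.le_ceil _, fun x => ?_⟩
  · have := Finset.sum_nonneg fun x (_ : x ∈ Finset.univ) => h0 x
    linarith
  · set N := ∑ x, 1 / (c x * δ) + 1
    have hN : 1 / (c x * δ) ≤ N := by
      have := Finset.single_le_sum (f := fun x => 1 / (c x * δ)) (fun x _ => h0 x)
        (Finset.mem_univ x)
      linarith
    have hNc : 1 ≤ N * c x * δ := by
      rw [div_le_iff₀ (mul_pos (hc x) hδ)] at hN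
      linarith
    have hpos : 0 ≤ N * c x := by
      have := (h0 x).trans hN
      have := hc x
      positivity
    have := (Nat.ceil_lt_add_one hpos).le
    linarith

end RealEstimates

/-! ### Orders above one: the lower bound by splitting inputs -/

section Split

variable {X Y : Type*}


/-- The law of a pair `(z, i)` with `i` uniform in `Fin (m z)`. -/
noncomputable def uniformFiber {S : Type*} (m : S → ℕ) (hm : ∀ z, m z ≠ 0) (z : S) :
    PMF (Σ z : S, Fin (m z)) :=
  haveI : NeZero (m z) := ⟨hm z⟩
  (PMF.uniformOfFintype (Fin (m z))).map (Sigma.mk z)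

open Classical in
theorem uniformFiber_apply {S : Type*} (m : S → ℕ) (hm : ∀ z, m z ≠ 0) (z z' : S)
    (i : Fin (m z')) :
    (uniformFiber m hm z ⟨z', i⟩).toReal = if z = z' then ((m z' : ℝ))⁻¹ else 0 := by
  simp only [uniformFiber, PMF.map_apply, PMF.uniformOfFintype_apply, tsum_fintype]
  by_cases h : z = z'
  · subst h
    simp [Sigma.mk.injEq]
  · rw [if_neg h, Finset.sum_eq_zero, ENNReal.toReal_zero]
    intro j _
    rw [if_neg]
    intro hj
    exact h (congrArg Sigma.fst hj).symm

open Classical in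
/-- The randomized function of the input that appends to `x ∈ S` a uniform label in `Fin (m x)`
(an input outside of `S` is first replaced by `x₀`). -/
noncomputable def splitChannel {S : Set X} (x₀ : S) (m : S → ℕ) (hm : ∀ x, m x ≠ 0) (x : X) :
    PMF (Σ x : S, Fin (m x)) :=
  uniformFiber m hm (if hx : x ∈ S then ⟨x, hx⟩ else x₀)

open Classical in
theorem splitChannel_apply {S : Set X} (x₀ : S) (m : S → ℕ) (hm : ∀ x, m x ≠ 0) (z z' : S)
    (i : Fin (m z')) :
    (splitChannel x₀ m hm z ⟨z', i⟩).toReal = if z = z' then ((m z' : ℝ))⁻¹ else 0 := by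
  have hz : (if hx : (z : X) ∈ S then (⟨z, hx⟩ : S) else x₀) = z := by simp
  rw [splitChannel, hz, uniformFiber_apply]
  congr

variable [Fintype X] [Fintype Y] (P : PMF X) (W : X → PMF Y)

open Classical in
theorem sum_support_eq (f : X → ℝ) :
    ∑ x, (P x).toReal * f x = ∑ x : P.support, (P x).toReal * f x := by
  rw [Finset.sum_set_coe P.support (f := fun x => (P x).toReal * f x)]
  refine (Finset.sum_subset (Finset.subset_univ _) fun x _ hx => ?_).symm
  rw [Set.mem_toFinset, PMF.mem_support_iff, not_not] at hx
  simp [hx]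

open Classical in
theorem logRatioReal_splitChannel (x₀ : P.support) (m : P.support → ℕ) (hm : ∀ x, m x ≠ 0)
    (a : ℝ) :
    logRatioReal P W (splitChannel x₀ m hm) a = a / (a - 1) *
      (Real.log (∑ y, (∑ x : P.support, (m x : ℝ) *
          ((P x).toReal / m x * (W x y).toReal) ^ a) ^ (1 / a))
        - Real.log ((∑ x : P.support, (m x : ℝ) * ((P x).toReal / m x) ^ a) ^ (1 / a))) := by
  have hj : ∀ (z : P.support) (i : Fin (m z)) (y : Y),
      jointReal P W (splitChannel x₀ m hm) ⟨z, i⟩ y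
        = (P z).toReal / m z * (W z y).toReal := by
    intro z i y
    simp only [jointReal, mul_assoc]
    rw [sum_support_eq P fun x => (splitChannel x₀ m hm x ⟨z, i⟩).toReal * (W x y).toReal]
    simp only [splitChannel_apply]
    rw [Finset.sum_eq_single z]
    · simp; ring
    · intro b _ hb; simp [hb]
    · simp
  have hmg : ∀ (z : P.support) (i : Fin (m z)),
      margReal P (splitChannel x₀ m hm) ⟨z, i⟩ = (P z).toReal / m z := by
    intro z i
    simp only [margReal]
    rw [sum_support_eq P fun x => (splitChannel x₀ m hm x ⟨z, i⟩).toReal]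
    simp only [splitChannel_apply]
    rw [Finset.sum_eq_single z]
    · simp; ring
    · intro b _ hb; simp [hb]
    · simp
  simp only [logRatioReal, obsReal, blindReal, powNorm, Fintype.sum_sigma, hj, hmg,
    Finset.sum_const, Finset.card_univ, Fintype.card_fin, nsmul_eq_mul]

open Classical in
-- The variable `U` must be fixed before the order tends to `α`. So `m` is tuned to the limiting
-- exponent `1 - 1 / α`, and continuity makes it accurate up to `1 + δ` at nearby orders. Positivity
-- of this exponent is where `1 < α` is needed.
theorem HardDistortion.neg_log_sub_le_maxAlphaLeakage {P : PMF X} {W : X → PMF Y}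
    {d : X → Y → ℝ} {D : ℝ} (h : HardDistortion d D P W) {α : ℝ≥0∞} (hα : 1 < α)
    {π : P.support → ℝ} (hπ : ∀ x, 0 < π x) (hπ1 : ∑ x, π x = 1) {s : ℝ} (hs0 : 0 < s)
    (hs : ∀ y, (∑ x : P.support, if d x y ≤ D then π x else 0) ≤ s) {δ : ℝ} (hδ : 0 < δ) :
    ((-Real.log s - (1 + 4 / (1 - (α⁻¹).toReal)) * Real.log (1 + δ) : ℝ) : EReal)
      ≤ maxAlphaLeakage α P W := by
  set θ := 1 - (α⁻¹).toReal with hθdef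
  have hθ : 0 < θ := by
    have : (α⁻¹).toReal < 1 := by
      simpa using (ENNReal.toReal_lt_toReal (ENNReal.inv_ne_top.2 (by positivity))
        ENNReal.one_ne_top).2 (ENNReal.inv_lt_one.2 hα)
    linarith
  have hp : ∀ x : P.support, 0 < (P x).toReal := fun x => toReal_pos_of_mem_support x.2
  -- The solution of `p c ^ (-θ) π ^ (θ - 1) = 1`.
  let c : P.support → ℝ := fun x => ((P x).toReal * π x ^ (θ - 1)) ^ (1 / θ)
  have hc : ∀ x, 0 < c x := fun x =>
    Real.rpow_pos_of_pos (mul_pos (hp x) (Real.rpow_pos_of_pos (hπ x) _)) _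
  obtain ⟨N, m, hN, hm1, hm2⟩ := exists_nat_approx hc hδ
  have hm : ∀ x, m x ≠ 0 := fun x h0 => by
    have h1 := hm1 x
    have h2 := mul_pos hN (hc x)
    rw [h0, Nat.cast_zero] at h1
    linarith
  obtain ⟨x₀, hx₀⟩ := P.support_nonempty
  let V := splitChannel ⟨x₀, hx₀⟩ m hm
  obtain ⟨L, hL⟩ := exists_tendsto_logGainRatio P W V hα.le
  refine le_trans ?_ (le_maxAlphaLeakage P W V hα.le hL)
  have := orderFilter_neBot hα.le
  have hlim := tendsto_sub_one_div_toReal (α := α) (by positivity)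
  rw [← hθdef] at hlim
  have he : ∀ x : P.support, Tendsto (fun t : ℝ => (P x).toReal * c x ^ (-t) * π x ^ (t - 1)) (𝓝 θ) (𝓝 1) := by
    intro x
    have hcont : Continuous (fun t : ℝ => (P x).toReal * c x ^ (-t) * π x ^ (t - 1)) := by
      refine (continuous_const.mul (continuous_const.rpow continuous_neg
        fun t => Or.inl (hc x).ne')).mul
        (continuous_const.rpow (continuous_id.sub continuous_const) fun t => Or.inl (hπ x).ne')
    have h1 : (P x).toReal * c x ^ (-θ) * π x ^ (θ - 1) = 1 := by
      have hpos : 0 < (P x).toReal * π x ^ (θ - 1) :=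
        mul_pos (hp x) (Real.rpow_pos_of_pos (hπ x) _)
      have h2 : c x ^ (-θ) = ((P x).toReal * π x ^ (θ - 1))⁻¹ := by
        rw [← Real.rpow_mul hpos.le, mul_neg, one_div_mul_cancel hθ.ne', Real.rpow_neg_one]
      rw [h2, mul_right_comm, mul_inv_cancel₀ hpos.ne']
    have := hcont.tendsto θ
    rwa [h1] at this
  have hev : ∀ᶠ b : ℝ≥0∞ in orderFilter α, ∀ x : P.support,
      (P x).toReal * c x ^ (-((b.toReal - 1) / b.toReal)) * π x ^ ((b.toReal - 1) / b.toReal - 1)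
        ∈ Set.Ioo (1 + δ)⁻¹ (1 + δ) := by
    refine eventually_all.2 fun x => ((he x).comp hlim).eventually
      (Ioo_mem_nhds (inv_lt_one_of_one_lt₀ (by linarith)) (by linarith))
  -- Bounds the error factor `2 / θ'` at nearby orders by the constant `4 / θ`.
  have hhalf : ∀ᶠ b : ℝ≥0∞ in orderFilter α, θ / 2 < (b.toReal - 1) / b.toReal :=
    hlim.eventually (lt_mem_nhds (by linarith))
  refine ge_of_tendsto hL ?_
  filter_upwards [eventually_one_lt_toReal α, hev, hhalf] with b hb hbe hbθ
  rw [logGainRatio_eq P W V hb, EReal.coe_le_coe_iff, logRatioReal_splitChannel]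
  have hmain := log_ratio_ge_of_split hb hs0 hN hδ hp hπ hπ1 hc
    (w := fun (x : P.support) y => (W x y).toReal) (B := fun x y => d x y ≤ D)
    (fun _ _ => ENNReal.toReal_nonneg) (fun x => sum_toReal_pmf (W x))
    (fun x y hxy => h x x.2 y fun h0 => by simp [h0] at hxy) hs hm1 hm2
    (fun x => (hbe x).1.le) (fun x => (hbe x).2.le)
  refine le_trans ?_ hmain
  have hlog : 0 ≤ Real.log (1 + δ) := Real.log_nonneg (by linarith)
  have hdiv : 2 / ((b.toReal - 1) / b.toReal) ≤ 4 / θ := by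
    have : (4 : ℝ) / θ = 2 / (θ / 2) := by field_simp; norm_num
    rw [this]
    exact div_le_div_of_nonneg_left (by norm_num) (by linarith) hbθ.le
  have := mul_le_mul_of_nonneg_right (add_le_add_right hdiv 1) hlog
  linarith

open Classical in
theorem HardDistortion.neg_log_le_maxAlphaLeakage {P : PMF X} {W : X → PMF Y}
    {d : X → Y → ℝ} {D : ℝ} (h : HardDistortion d D P W) {α : ℝ≥0∞} (hα : 1 < α)
    {π : P.support → ℝ} (hπ : ∀ x, 0 < π x) (hπ1 : ∑ x, π x = 1) {s : ℝ} (hs0 : 0 < s)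
    (hs : ∀ y, (∑ x : P.support, if d x y ≤ D then π x else 0) ≤ s) :
    ((-Real.log s : ℝ) : EReal) ≤ maxAlphaLeakage α P W := by
  have hlim : Tendsto (fun δ : ℝ => ((-Real.log s - (1 + 4 / (1 - (α⁻¹).toReal)) *
      Real.log (1 + δ) : ℝ) : EReal)) (𝓝[>] 0) (𝓝 ((-Real.log s : ℝ) : EReal)) := by
    refine (continuous_coe_real_ereal.tendsto _).comp ?_
    have h1 : Tendsto (fun δ : ℝ => Real.log (1 + δ)) (𝓝 0) (𝓝 (Real.log (1 + 0))) :=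
      ((continuous_const.add continuous_id).tendsto (0 : ℝ)).log (by norm_num)
    rw [add_zero, Real.log_one] at h1
    simpa using ((h1.mono_left nhdsWithin_le_nhds).const_mul
      (1 + 4 / (1 - (α⁻¹).toReal))).const_sub (-Real.log s)
  exact le_of_tendsto hlim (eventually_nhdsWithin_of_forall fun δ hδ =>
    h.neg_log_sub_le_maxAlphaLeakage hα hπ hπ1 hs0 hs hδ)

end Split

/-! ### The matrix game -/

section Minimax

variable {ι Y : Type*} [Fintype ι] [Fintype Y]

open Classical in
/-- The minimax theorem for matrix games. -/
theorem exists_mem_stdSimplex_sum_le [Nonempty ι] [Nonempty Y] (A : Matrix ι Y ℝ) {v : ℝ}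
    (h : ∀ q ∈ stdSimplex ℝ Y, ∃ x, ∑ y, A x y * q y ≤ v) :
    ∃ π ∈ stdSimplex ℝ ι, ∀ y, ∑ x, π x * A x y ≤ v := by
  let B : (ι → ℝ) →ₗ[ℝ] (Y → ℝ) →ₗ[ℝ] ℝ := Matrix.toLinearMap₂' ℝ A
  have hB : ∀ π q, B π q = π ⬝ᵥ A.mulVec q := fun π q => Matrix.toLinearMap₂'_apply' A π q
  obtain ⟨π, hπ, q, hq, hsaddle⟩ := Sion.exists_isSaddlePointOn
    (X := stdSimplex ℝ ι) (Y := stdSimplex ℝ Y) (f := fun π q => B π q)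
    ⟨_, single_mem_stdSimplex ℝ (Classical.arbitrary ι)⟩ (convex_stdSimplex ℝ ι)
    (isCompact_stdSimplex ℝ ι)
    (fun q _ => (LinearMap.continuous_of_finiteDimensional (B.flip q)).continuousOn
      |>.lowerSemicontinuousOn)
    (fun q _ => ((B.flip q).convexOn (convex_stdSimplex ℝ ι)).quasiconvexOn)
    (convex_stdSimplex ℝ Y) ⟨_, single_mem_stdSimplex ℝ (Classical.arbitrary Y)⟩
    (isCompact_stdSimplex ℝ Y)
    (fun π _ => (LinearMap.continuous_of_finiteDimensional (B π)).continuousOn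
      |>.upperSemicontinuousOn)
    (fun π _ => ((B π).concaveOn (convex_stdSimplex ℝ Y)).quasiconcaveOn)
  obtain ⟨x, hx⟩ := h q hq
  refine ⟨π, hπ, fun y => ?_⟩
  -- The saddle inequality against pure strategies: `π` against `y` pays at most what `x` against
  -- `q` pays.
  have h1 := hsaddle _ (single_mem_stdSimplex ℝ x) _ (single_mem_stdSimplex ℝ y)
  simp only [hB, Matrix.mulVec_single_one, single_one_dotProduct] at h1
  exact h1.trans hx

/-- The splitting argument takes negative powers of `π`, so the optimal strategy is mixed with a
little of the uniform one, at the price of `s > v`. -/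
theorem exists_pos_mem_stdSimplex_sum_le [Nonempty ι] [Nonempty Y] {A : Matrix ι Y ℝ}
    (hA : ∀ x y, A x y ≤ 1) {v s : ℝ} (hv : 0 ≤ v) (hs : v < s)
    (h : ∀ q ∈ stdSimplex ℝ Y, ∃ x, ∑ y, A x y * q y ≤ v) :
    ∃ π : ι → ℝ, (∀ x, 0 < π x) ∧ ∑ x, π x = 1 ∧ ∀ y, ∑ x, π x * A x y ≤ s := by
  obtain ⟨π, ⟨hπ0, hπ1⟩, hπ⟩ := exists_mem_stdSimplex_sum_le A h
  have hn : (0 : ℝ) < Fintype.card ι := by exact_mod_cast Fintype.card_pos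
  obtain ⟨ε, hε0, hε⟩ : ∃ ε : ℝ, 0 < ε ∧ ε < min 1 (s - v) :=
    exists_between (lt_min one_pos (sub_pos.2 hs))
  have hε1 := (lt_min_iff.1 hε).1
  have hεs := (lt_min_iff.1 hε).2
  refine ⟨fun x => (1 - ε) * π x + ε / Fintype.card ι, fun x => ?_, ?_, fun y => ?_⟩
  · have := mul_nonneg (sub_nonneg.2 hε1.le) (hπ0 x)
    have : 0 < ε / Fintype.card ι := by positivity
    linarith
  · rw [Finset.sum_add_distrib, ← Finset.mul_sum, hπ1]
    simp only [Finset.sum_const, Finset.card_univ, nsmul_eq_mul]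
    field_simp
    ring
  · calc ∑ x, ((1 - ε) * π x + ε / Fintype.card ι) * A x y
        = (1 - ε) * ∑ x, π x * A x y + ∑ x, ε / Fintype.card ι * A x y := by
          rw [Finset.mul_sum, ← Finset.sum_add_distrib]
          exact Finset.sum_congr rfl fun x _ => by ring
      _ ≤ (1 - ε) * v + ∑ _x : ι, ε / Fintype.card ι * 1 := by
          refine add_le_add (mul_le_mul_of_nonneg_left (hπ y) (sub_nonneg.2 hε1.le))
            (Finset.sum_le_sum fun x _ => mul_le_mul_of_nonneg_left (hA x y) (by positivity))
      _ = (1 - ε) * v + ε := by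
          simp only [Finset.sum_const, Finset.card_univ, nsmul_eq_mul]
          field_simp
      _ ≤ s := by nlinarith [mul_nonneg hε0.le hv]

end Minimax

/-! ### Existence of optimal output laws -/

section Attainment

variable {X Y : Type*} [Fintype Y]

/-- The distribution given by a point of the standard simplex. -/
noncomputable def ofSimplex (q : stdSimplex ℝ Y) : PMF Y :=
  PMF.ofFintype (fun y => ENNReal.ofReal (q.1 y)) (by
    rw [← ENNReal.ofReal_sum_of_nonneg fun y _ => q.2.1 y, q.2.2, ENNReal.ofReal_one])

theorem toReal_ofSimplex (q : stdSimplex ℝ Y) (y : Y) : (ofSimplex q y).toReal = q.1 y := by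
  rw [ofSimplex, PMF.ofFintype_apply, ENNReal.toReal_ofReal (q.2.1 y)]

theorem ofSimplex_surjective : Function.Surjective (ofSimplex (Y := Y)) := fun Q =>
  ⟨⟨fun y => (Q y).toReal, fun _ => ENNReal.toReal_nonneg, sum_toReal_pmf Q⟩, by
    ext y
    rw [ofSimplex, PMF.ofFintype_apply, ENNReal.ofReal_toReal (Q.apply_ne_top y)]⟩

theorem exists_pmf_forall_le [Nonempty Y] {β : Type*} [LinearOrder β] {F : PMF Y → β}
    (hF : UpperSemicontinuous fun q => F (ofSimplex q)) : ∃ Q, ∀ Q', F Q' ≤ F Q := by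
  classical
  have : CompactSpace (stdSimplex ℝ Y) := isCompact_iff_compactSpace.1 (isCompact_stdSimplex ℝ Y)
  have hne : (Set.univ : Set (stdSimplex ℝ Y)).Nonempty :=
    ⟨⟨_, single_mem_stdSimplex ℝ (Classical.arbitrary Y)⟩, trivial⟩
  obtain ⟨q, -, hq⟩ := (hF.upperSemicontinuousOn _).exists_isMaxOn hne isCompact_univ
  refine ⟨ofSimplex q, fun Q' => ?_⟩
  obtain ⟨q', rfl⟩ := ofSimplex_surjective Q'
  exact hq (Set.mem_univ q')

variable (d : X → Y → ℝ) (D : ℝ)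

theorem continuous_toReal_ballProb (x : X) :
    Continuous fun q => (ballProb d D (ofSimplex q) x).toReal := by
  classical
  simp only [toReal_ballProb, toReal_ofSimplex]
  refine continuous_finsetSum _ fun y _ => ?_
  split_ifs
  · exact (continuous_apply y).comp continuous_subtype_val
  · exact continuous_const

theorem continuous_ballProb (x : X) : Continuous fun q => ballProb d D (ofSimplex q) x :=
  (ENNReal.continuous_ofReal.comp (continuous_toReal_ballProb d D x)).congr fun _ =>
    ENNReal.ofReal_toReal (ballProb_ne_top d D _ x)

theorem exists_minBallProb_eq_qStar [Nonempty Y] (S : Set X) :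
    ∃ Q : PMF Y, minBallProb d D S Q = qStar d D S := by
  have h : UpperSemicontinuous fun q => minBallProb d D S (ofSimplex (Y := Y) q) :=
    upperSemicontinuous_biInf fun x _ => (continuous_ballProb d D x).upperSemicontinuous
  obtain ⟨Q, hQ⟩ := exists_pmf_forall_le h
  exact ⟨Q, le_antisymm (le_iSup (minBallProb d D S) Q) (iSup_le hQ)⟩

theorem ballProb_uniform_ne_zero [Nonempty Y] {x : X} (hx : (ball d D x).Nonempty) :
    ballProb d D (PMF.uniformOfFintype Y) x ≠ 0 := by
  obtain ⟨y, hy⟩ := hx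
  rw [ballProb, Ne, PMF.toOuterMeasure_apply_eq_zero_iff, Set.disjoint_left]
  intro h
  exact h (PMF.mem_support_uniformOfFintype y) hy

variable [Fintype X]

theorem minBallProb_ne_zero {X Y : Type*} [Finite X] (d : X → Y → ℝ) (D : ℝ) {P : PMF X} {Q : PMF Y}
    (h : ∀ x ∈ P.support, ballProb d D Q x ≠ 0) : minBallProb d D P.support Q ≠ 0 := by
  have : Nonempty P.support := P.support_nonempty.to_subtype
  obtain ⟨x, hx⟩ := Finite.exists_min fun x : P.support => ballProb d D Q x
  have h1 : ballProb d D Q x ≤ minBallProb d D P.support Q := le_iInf₂ fun z hz => hx ⟨z, hz⟩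
  exact ((pos_iff_ne_zero.2 (h x x.2)).trans_le h1).ne'

theorem qStar_ne_zero [Nonempty Y] {P : PMF X} (h : ∀ x ∈ P.support, (ball d D x).Nonempty) :
    qStar d D P.support ≠ 0 :=
  ((pos_iff_ne_zero.2 (minBallProb_ne_zero d D fun x hx =>
    ballProb_uniform_ne_zero d D (h x hx))).trans_le
      (le_iSup (minBallProb d D P.support) (PMF.uniformOfFintype Y))).ne'

/-- All summands are nonnegative because ball probabilities are at most `1`, so the infinite term
cannot be cancelled. -/
theorem expLogInvBall_eq_top {P : PMF X} {Q : PMF Y} {x : X} (hx : x ∈ P.support)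
    (h : ballProb d D Q x = 0) : expLogInvBall d D P Q = ⊤ := by
  have h0 : ∀ x, 0 ≤ (P x : EReal) * ENNReal.log (1 / ballProb d D Q x) := fun x =>
    mul_nonneg (EReal.coe_ennreal_nonneg _) (ENNReal.zero_le_log_iff.2
      (by rw [one_div]; exact ENNReal.one_le_inv.2 (ballProb_le_one d D Q x)))
  have h1 := Finset.single_le_sum (fun x _ => h0 x) (Finset.mem_univ x)
  rw [h, ENNReal.div_zero one_ne_zero, ENNReal.log_top, ereal_coe_eq,
    EReal.coe_mul_top_of_pos (toReal_pos_of_mem_support hx)] at h1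
  exact top_le_iff.1 h1

/-- The objective may be infinite, so one maximizes `∏ x, Q(B_D(x)) ^ P x`, its negative
exponential, which is real and continuous in `Q`. The uniform law makes it positive, so a maximizer
has finite objective. -/
theorem exists_expLogInvBall_eq_iInf [Nonempty Y] {P : PMF X}
    (h : ∀ x ∈ P.support, (ball d D x).Nonempty) :
    ∃ Q : PMF Y, expLogInvBall d D P Q = ⨅ Q' : PMF Y, expLogInvBall d D P Q' := by
  let M : PMF Y → ℝ := fun Q => ∏ x, (ballProb d D Q x).toReal ^ (P x).toReal
  have hM : UpperSemicontinuous fun q => M (ofSimplex q) :=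
    (continuous_finsetProd _ fun x _ => (continuous_toReal_ballProb d D x).rpow_const
      fun _ => Or.inr ENNReal.toReal_nonneg).upperSemicontinuous
  have hpos : ∀ Q, (∀ x ∈ P.support, ballProb d D Q x ≠ 0) → ∀ x,
      0 < (ballProb d D Q x).toReal ^ (P x).toReal := by
    intro Q hQ x
    by_cases hx : x ∈ P.support
    · exact Real.rpow_pos_of_pos (ENNReal.toReal_pos (hQ x hx) (ballProb_ne_top d D Q x)) _
    · rw [PMF.mem_support_iff, not_not] at hx
      simp [hx]
  have hval : ∀ Q, (∀ x ∈ P.support, ballProb d D Q x ≠ 0) →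
      expLogInvBall d D P Q = ((-Real.log (M Q) : ℝ) : EReal) := by
    intro Q hQ
    rw [expLogInvBall_eq_coe d D hQ, Real.log_prod fun x _ => (hpos Q hQ x).ne',
      ← Finset.sum_neg_distrib]
    congr 1
    refine Finset.sum_congr rfl fun x _ => ?_
    by_cases hx : x ∈ P.support
    · rw [Real.log_rpow (ENNReal.toReal_pos (hQ x hx) (ballProb_ne_top d D Q x))]
      ring
    · rw [PMF.mem_support_iff, not_not] at hx
      simp [hx]
  obtain ⟨Q, hQ⟩ := exists_pmf_forall_le hM
  have hne : ∀ x ∈ P.support, ballProb d D Q x ≠ 0 := by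
    intro x hx h0
    have h1 : M Q = 0 := Finset.prod_eq_zero (Finset.mem_univ x) (by
      rw [h0, ENNReal.toReal_zero, Real.zero_rpow (toReal_pos_of_mem_support hx).ne'])
    have h2 : 0 < M (PMF.uniformOfFintype Y) := Finset.prod_pos fun z _ =>
      hpos _ (fun z hz => ballProb_uniform_ne_zero d D (h z hz)) z
    exact absurd (hQ (PMF.uniformOfFintype Y)) (by rw [h1]; exact not_le.2 h2)
  refine ⟨Q, le_antisymm (le_iInf fun Q' => ?_) (iInf_le _ Q)⟩
  by_cases hQ' : ∀ x ∈ P.support, ballProb d D Q' x ≠ 0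
  · rw [hval Q hne, hval Q' hQ', EReal.coe_le_coe_iff, neg_le_neg_iff]
    exact Real.log_le_log (Finset.prod_pos fun x _ => hpos Q' hQ' x) (hQ Q')
  · push Not at hQ'
    obtain ⟨x, hx, h0⟩ := hQ'
    rw [expLogInvBall_eq_top d D hx h0]
    exact le_top

end Attainment

/-! ### The optimal tradeoff and its mechanisms -/

section Tradeoff

variable {X Y : Type*} [Fintype X] [Fintype Y] {d : X → Y → ℝ} {D : ℝ} {P : PMF X}

theorem qStar_ne_top {X : Type*} {d : X → Y → ℝ} {P : PMF X} : qStar d D P.support ≠ ⊤ := by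
  obtain ⟨x, hx⟩ := P.support_nonempty
  have h : qStar d D P.support ≤ 1 := iSup_le fun Q =>
    (iInf₂_le x hx).trans (ballProb_le_one d D Q x)
  exact (h.trans_lt ENNReal.one_lt_top).ne

theorem HardDistortion.neg_log_qStar_le {W : X → PMF Y} (h : HardDistortion d D P W)
    {α : ℝ≥0∞} (hα : 1 < α) :
    -ENNReal.log (qStar d D P.support) ≤ maxAlphaLeakage α P W := by
  classical
  have : Nonempty X := nonempty_of_pmf P
  have : Nonempty Y := nonempty_of_channel W
  have : Nonempty P.support := P.support_nonempty.to_subtype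
  set v := (qStar d D P.support).toReal with hv
  have hgame : ∀ q ∈ stdSimplex ℝ Y, ∃ x : P.support,
      ∑ y, (if d x y ≤ D then (1 : ℝ) else 0) * q y ≤ v := by
    intro q hq
    obtain ⟨x, hx⟩ := Finite.exists_min fun x : P.support => ballProb d D (ofSimplex ⟨q, hq⟩) x
    refine ⟨x, ?_⟩
    have h1 : ballProb d D (ofSimplex ⟨q, hq⟩) x ≤ qStar d D P.support :=
      le_trans (le_iInf₂ fun z hz => hx ⟨z, hz⟩)
        (le_iSup (minBallProb d D P.support) (ofSimplex ⟨q, hq⟩))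
    have h2 := (ENNReal.toReal_le_toReal (ballProb_ne_top d D _ _) qStar_ne_top).2 h1
    rw [toReal_ballProb] at h2
    simpa only [toReal_ofSimplex, ite_mul, one_mul, zero_mul] using h2
  -- Working strictly above `v` keeps `s` positive even when `q⋆ = 0`; the limit `s → v` then yields
  -- `⊤`.
  have hs : ∀ s : ℝ, v < s → -ENNReal.log (ENNReal.ofReal s) ≤ maxAlphaLeakage α P W := by
    intro s hvs
    have hs0 : 0 < s := ENNReal.toReal_nonneg.trans_lt hvs
    obtain ⟨π, hπ0, hπ1, hπ⟩ := exists_pos_mem_stdSimplex_sum_le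
      (A := fun (x : P.support) y => if d x y ≤ D then (1 : ℝ) else 0)
      (fun x y => by split_ifs <;> norm_num) ENNReal.toReal_nonneg hvs hgame
    rw [ENNReal.log_ofReal_of_pos hs0, ← EReal.coe_neg]
    refine h.neg_log_le_maxAlphaLeakage hα hπ0 hπ1 hs0 fun y => ?_
    simpa only [mul_ite, mul_one, mul_zero] using hπ y
  have hlim : Tendsto (fun s : ℝ => -ENNReal.log (ENNReal.ofReal s)) (𝓝[>] v)
      (𝓝 (-ENNReal.log (ENNReal.ofReal v))) :=
    ((continuous_neg.comp (ENNReal.continuous_log.comp ENNReal.continuous_ofReal)).tendsto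
      v).mono_left nhdsWithin_le_nhds
  rw [hv, ENNReal.ofReal_toReal qStar_ne_top] at hlim
  exact le_of_tendsto hlim (eventually_nhdsWithin_of_forall hs)

theorem hardPUT_one_eq : hardPUT 1 d D P = ⨅ Q : PMF Y, expLogInvBall d D P Q := by
  refine le_antisymm (le_iInf fun Q => ?_) (le_iInf₂ fun W hW => hW.iInf_expLogInvBall_le)
  by_cases hQ : ∀ x ∈ P.support, ballProb d D Q x ≠ 0
  · obtain ⟨W, hW⟩ := exists_isBallRestriction d D hQ
    exact (iInf₂_le W hW.hardDistortion).trans hW.maxAlphaLeakage_one_le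
  · push Not at hQ
    obtain ⟨x, hx, h0⟩ := hQ
    rw [expLogInvBall_eq_top d D hx h0]
    exact le_top

theorem hardPUT_eq {α : ℝ≥0∞} (hα : 1 < α) :
    hardPUT α d D P = -ENNReal.log (qStar d D P.support) := by
  refine le_antisymm ?_ (le_iInf₂ fun W hW => hW.neg_log_qStar_le hα)
  by_cases h0 : qStar d D P.support = 0
  · simp [h0]
  · have : Nonempty Y := by
      by_contra h
      rw [not_nonempty_iff] at h
      have : IsEmpty (PMF Y) := ⟨fun Q => h.elim (nonempty_of_pmf Q).some⟩
      exact h0 (by simp [qStar])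
    obtain ⟨Q, hQ⟩ := exists_minBallProb_eq_qStar d D P.support
    have hne : ∀ x ∈ P.support, ballProb d D Q x ≠ 0 := fun x hx hx0 =>
      h0 (hQ ▸ le_bot_iff.1 ((iInf₂_le x hx).trans_eq hx0))
    obtain ⟨W, hW⟩ := exists_isBallRestriction d D hne
    rw [← hQ]
    exact (iInf₂_le W hW.hardDistortion).trans (hW.maxAlphaLeakage_le hα.le)

theorem IsBallRestriction.isOptimalMechanism_one {Q : PMF Y} {W : X → PMF Y}
    (h : IsBallRestriction d D P.support Q W)
    (hQ : expLogInvBall d D P Q = ⨅ Q' : PMF Y, expLogInvBall d D P Q') :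
    IsOptimalMechanism 1 d D P W := by
  refine ⟨h.hardDistortion, le_antisymm ?_ (iInf₂_le W h.hardDistortion)⟩
  rw [hardPUT_one_eq, ← hQ]
  exact h.maxAlphaLeakage_one_le

theorem IsBallRestriction.isOptimalMechanism {Q : PMF Y} {W : X → PMF Y}
    (h : IsBallRestriction d D P.support Q W)
    (hQ : minBallProb d D P.support Q = qStar d D P.support) {α : ℝ≥0∞} (hα : 1 < α) :
    IsOptimalMechanism α d D P W := by
  refine ⟨h.hardDistortion, le_antisymm ?_ (iInf₂_le W h.hardDistortion)⟩
  rw [hardPUT_eq hα, ← hQ]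
  exact h.maxAlphaLeakage_le hα.le

end Tradeoff

end AlphaLeak

theorem theorem4 {X Y : Type*} [Fintype X] [Fintype Y]
    (P : PMF X) (d : X → Y → ℝ) (D : ℝ) :
    -- the limit in the definition of maximal leakage exists
    (∀ α : ℝ≥0∞, 1 ≤ α → ∀ (W : X → PMF Y) (n : ℕ) (V : X → PMF (Fin n)),
      ∃ L : EReal,
        Tendsto (fun α' : ℝ≥0∞ => logGainRatio α'.toReal P W V) (orderFilter α) (𝓝 L)) ∧
    -- the optimal tradeoff for order one and for orders above one
    hardPUT 1 d D P = ⨅ Q : PMF Y, expLogInvBall d D P Q ∧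
    (∀ α : ℝ≥0∞, 1 < α → hardPUT α d D P = -ENNReal.log (qStar d D P.support)) ∧
    -- optimal mechanisms, when the distortion constraint can be met
    ((∀ x ∈ P.support, (ball d D x).Nonempty) →
      -- order one
      ((∃ Q : PMF Y, expLogInvBall d D P Q = ⨅ Q' : PMF Y, expLogInvBall d D P Q') ∧
        ∀ Q : PMF Y, expLogInvBall d D P Q = ⨅ Q' : PMF Y, expLogInvBall d D P Q' →
          (∃ W : X → PMF Y, IsBallRestriction d D P.support Q W) ∧
          ∀ W : X → PMF Y, IsBallRestriction d D P.support Q W →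
            IsOptimalMechanism 1 d D P W) ∧
      -- orders above one: one mechanism for all orders and all input laws with this support
      ((∃ Q : PMF Y, minBallProb d D P.support Q = qStar d D P.support) ∧
        ∀ Q : PMF Y, minBallProb d D P.support Q = qStar d D P.support →
          (∃ W : X → PMF Y, IsBallRestriction d D P.support Q W) ∧
          ∀ W : X → PMF Y, IsBallRestriction d D P.support Q W →
            ∀ α : ℝ≥0∞, 1 < α → ∀ P' : PMF X, P'.support = P.support →
              IsOptimalMechanism α d D P' W)) := by
  refine ⟨fun α hα W n V => ?_, hardPUT_one_eq, fun α hα => hardPUT_eq hα, fun hne => ?_⟩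
  · obtain ⟨L, hL⟩ := exists_tendsto_logGainRatio P W V hα
    exact ⟨L, hL⟩
  have hY : Nonempty Y := by
    obtain ⟨x, hx⟩ := P.support_nonempty
    exact (hne x hx).to_type
  refine ⟨⟨exists_expLogInvBall_eq_iInf d D hne, fun Q hQ => ⟨?_, fun W hW =>
    hW.isOptimalMechanism_one hQ⟩⟩, exists_minBallProb_eq_qStar d D P.support, fun Q hQ =>
    ⟨?_, fun W hW α hα P' hP' => ?_⟩⟩
  -- The uniform law has finite objective, so a minimizer cannot give a ball of a possible input
  -- mass zero.
  · refine exists_isBallRestriction d D fun x hx h0 => ?_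
    have h1 : expLogInvBall d D P (PMF.uniformOfFintype Y) = ⊤ :=
      top_le_iff.1 ((expLogInvBall_eq_top d D hx h0).symm.trans_le (hQ.trans_le (iInf_le _ _)))
    rw [expLogInvBall_eq_coe d D fun z hz => ballProb_uniform_ne_zero d D (hne z hz)] at h1
    exact EReal.coe_ne_top _ h1
  · refine exists_isBallRestriction d D fun x hx h0 => qStar_ne_zero d D hne ?_
    exact hQ ▸ le_bot_iff.1 ((iInf₂_le x hx).trans_eq h0)
  -- The input law enters both hypotheses only through its support.
  · rw [← hP'] at hW hQ
    exact hW.isOptimalMechanism hQ hα
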